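/- Let $D\ge 2$ be an integer and let $\lambda=\log D$ be the Lyapunov exponent of the $D$-baker's map $B(q,p)=\big(Dq \bmod 1,\ (p+\lfloor Dq\rfloor)/D\big)$ on $\mathbb T^2=(\mathbb R/\mathbb Z)^2\simeq[0,1)^2$. For $k\ge 1$ let $\mathcal H_{D^k}=(\mathbb C^D)^{\otimes k}$, with its basis $e_{\epsilon_1}\otimes\dots\otimes e_{\epsilon_k}$ ($\epsilon_i\in\{0,\dots,D-1\}$) identified with the position basis $\mathbf q_j$, where $j/D^k=0.\epsilon_1\cdots\epsilon_k$ in base $D$. Let $\mathcal F_{jl}=D^{-1/2}e^{-2\pi i jl/D}$ be the Fourier matrix on $\mathbb C^D$, let $W_{D^k}$ be the Walsh transform $W_{D^k}(v^{(1)}\otimes\cdots\otimes v^{(k)})=\mathcal F v^{(k)}\otimes\cdots\otimes\mathcal F v^{(1)}$, and let $B_k=W_{D^k}^{-1}\,\mathrm{diag}(W_{D^{k-1}},\dots,W_{D^{k-1}})$ ($D$ blocks) be the Walsh-quantized baker. For $0\le\ell\le k$ and words $\epsilon=\epsilon_1\cdots\epsilon_\ell$, $\epsilon'=\epsilon'_1\cdots\epsilon'_{k-\ell}$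 put $$|\epsilon'\cdot\epsilon\rangle=e_{\epsilon_1}\otimes\cdots\otimes e_{\epsilon_\ell}\otimes\mathcal F^*e_{\epsilon'_{k-\ell}}\otimes\cdots\otimes\mathcal F^*e_{\epsilon'_1}.$$ For a unit vector $\psi\in\mathcal H_{D^k}$, the Walsh-Husimi measure $WH^{k,\ell}_\psi$ is the probability measure on $\mathbb T^2$ whose Lebesgue density equals $D^k|\langle\psi|\epsilon'\cdot\epsilon\rangle|^2$ on the rectangle of the points $(q,p)$ such that the $D$-ary expansion of $q$ begins with $\epsilon$ and that of $p$ begins with $\epsilon'$. Through $D$-ary expansions, $WH^{k,\ell}_\psi$ is also a probability measure on the space $\Sigma$ of two-sided sequences $\epsilon'\cdot\epsilon$, with the product topology, on which $B$ acts as the shift. A probability measure $\mu$, on $\mathbb T^2$ or on $\Sigma$, is called a semiclassical measure if there are integers $0\le\ell_j\le k_j$ with $k_j\to\infty$, $\ell_j\to\infty$, $k_j-\ell_j\to\infty$ and normalized eigenstates $\psi_j\in\mathcal H_{D^{k_j}}$ of $B_{k_j}$ such that $WH^{k_j,\ell_j}_{\psi_j}\to\mu$ weakly (on $\mathbb T^2$,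 respectively on $\Sigma$). Theorem. Every semiclassical measure $\mu$ (on $\mathbb T^2$, respectively on $\Sigma$) is invariant under $B$ (respectively under the shift), and its Kolmogorov-Sinai entropy satisfies $$h_{KS}(\mu)\ \ge\ \frac{\log D}{2}=\frac{\lambda}{2}.$$ -/

import Mathlib

open MeasureTheory Filter Topology
open scoped Matrix

noncomputable section

namespace WalshBaker

/-! ### Kolmogorov-Sinai entropy -/

/-- A finite measurable partition `(P_1, …, P_m)` of a measurable space (empty cells allowed). -/
structure MeasurablePartition (X : Type*) [MeasurableSpace X] (m : ℕ) where
  cell : Fin m → Set X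
  measurableSet_cell : ∀ i, MeasurableSet (cell i)
  disjoint_cell : ∀ i j, i ≠ j → Disjoint (cell i) (cell j)
  iUnion_cell : (⋃ i, cell i) = Set.univ

/-- The cells of `P ∨ T⁻¹P ∨ … ∨ T^{-(n-1)}P`, labelled by words of length `n`. -/
def MeasurablePartition.refinedCell {X : Type*} [MeasurableSpace X] {m : ℕ}
    (P : MeasurablePartition X m) (T : X → X) (n : ℕ) (a : Fin n → Fin m) : Set X :=
  ⋂ i : Fin n, T^[(i : ℕ)] ⁻¹' P.cell (a i)

/-- The entropy `-∑ μ(P_i) log μ(P_i)` of a finite family of cells. -/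
def cellEntropy {X : Type*} [MeasurableSpace X] {ι : Type*} [Fintype ι]
    (μ : Measure X) (c : ι → Set X) : ℝ :=
  ∑ i, Real.negMulLog (μ.real (c i))

/-- The entropy of `μ` for the action of `T` with respect to `P`: the limit of
`(1/n) h(P ∨ T⁻¹P ∨ … ∨ T^{-(n-1)}P)`. For a `T`-invariant probability measure this limit exists
by subadditivity, and the lower limit written here is that limit. -/
def entropyOfPartition {X : Type*} [MeasurableSpace X] {m : ℕ}
    (T : X → X) (μ : Measure X) (P : MeasurablePartition X m) : EReal :=
  liminf (fun n : ℕ => ((cellEntropy μ (P.refinedCell T n) / (n : ℝ) : ℝ) : EReal)) atTop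

/-- The Kolmogorov-Sinai entropy of `(X, T, μ)`: the supremum over all finite measurable
partitions. -/
def ksEntropy {X : Type*} [MeasurableSpace X] (T : X → X) (μ : Measure X) : EReal :=
  ⨆ (m : ℕ) (P : MeasurablePartition X m), entropyOfPartition T μ P

/-! ### The baker's map on the torus and its symbolic version -/

/-- The torus `(ℝ/ℤ)²`, with points `(q, p)`. -/
abbrev Torus : Type := UnitAddCircle × UnitAddCircle

/-- The representative in `[0, 1)` of a point of `ℝ/ℤ`. -/
def rep (q : UnitAddCircle) : ℝ := (AddCircle.equivIco (1 : ℝ) 0 q : ℝ)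

/-- The `D`-baker's map `(q, p) ↦ (D q mod 1, (p + ⌊D q⌋) / D)`. -/
def baker (D : ℕ) (x : Torus) : Torus :=
  (((D * rep x.1 : ℝ) : UnitAddCircle),
    (((rep x.2 + (⌊D * rep x.1⌋ : ℝ)) / D : ℝ) : UnitAddCircle))

/-- Two-sided sequences `ε'·ε`, stored as the pair `(ε, ε')` (position digits, then momentum
digits), with the product topology; `ε_{i+1}` is `x.1 i` and `ε'_{i+1}` is `x.2 i`. -/
abbrev SymbolSpace (D : ℕ) : Type := (ℕ → Fin D) × (ℕ → Fin D)

/-- The shift `… ε'₂ ε'₁ · ε₁ ε₂ … ↦ … ε'₂ ε'₁ ε₁ · ε₂ ε₃ …`. -/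
def shift (D : ℕ) (x : SymbolSpace D) : SymbolSpace D :=
  (fun n => x.1 (n + 1), fun n => Nat.casesOn n (x.1 0) x.2)

/-- The `D`-ary expansions of the coordinates of a point of the torus. -/
def coding (D : ℕ) [NeZero D] (x : Torus) : SymbolSpace D :=
  (Real.digits (rep x.1) D, Real.digits (rep x.2) D)

/-! ### Walsh quantization

The quantum space `(ℂ^D)^{⊗k}` is realized in its position basis
`e_{ε₁} ⊗ … ⊗ e_{ε_k}`, which is indexed by the words `ε₁ … ε_k`. -/

/-- The quantum space of dimension `D ^ k`. -/
abbrev QuantumSpace (D k : ℕ) : Type := EuclideanSpace ℂ (Fin k → Fin D)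

/-- The discrete Fourier transform `F_{jl} = D^{-1/2} exp(-2 i π j l / D)` on `ℂ^D`. -/
def fourier (D : ℕ) : Matrix (Fin D) (Fin D) ℂ :=
  Matrix.of fun j l =>
    ((Real.sqrt D : ℝ) : ℂ)⁻¹ *
      Complex.exp (-2 * Complex.I * Real.pi * ((j : ℕ) : ℂ) * ((l : ℕ) : ℂ) / (D : ℂ))

/-- The Walsh transform
`v⁽¹⁾ ⊗ … ⊗ v⁽ᵏ⁾ ↦ F v⁽ᵏ⁾ ⊗ … ⊗ F v⁽¹⁾`, as a matrix in the position basis. -/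
def walsh (D k : ℕ) : Matrix (Fin k → Fin D) (Fin k → Fin D) ℂ :=
  Matrix.of fun α β => ∏ i : Fin k, fourier D (α i) (β i.rev)

/-- The block-diagonal matrix with `D` blocks, all equal to the Walsh transform on `k` digits; the
blocks are labelled by the first digit. -/
def walshBlocks (D k : ℕ) : Matrix (Fin (k + 1) → Fin D) (Fin (k + 1) → Fin D) ℂ :=
  Matrix.of fun α β => if α 0 = β 0 then walsh D k (Fin.tail α) (Fin.tail β) else 0

/-- The Walsh-quantized baker `B_k` on the space of dimension `D ^ k`, `k ≥ 1` (the value at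
`k = 0` is a convention and plays no role). -/
def walshBaker (D : ℕ) : (k : ℕ) → Matrix (Fin k → Fin D) (Fin k → Fin D) ℂ
  | 0 => 1
  | k + 1 => (walsh D (k + 1))⁻¹ * walshBlocks D k

/-- `ψ` is a normalized eigenstate of `B_k`. -/
def IsEigenstate (D k : ℕ) (ψ : QuantumSpace D k) : Prop :=
  ‖ψ‖ = 1 ∧ ∃ z : ℂ, walshBaker D k *ᵥ ψ.ofLp = z • ψ.ofLp

/-- The Walsh coherent state
`|ε'·ε⟩ = e_{ε₁} ⊗ … ⊗ e_{ε_ℓ} ⊗ F* e_{ε'_{k-ℓ}} ⊗ … ⊗ F* e_{ε'₁}`, for `0 ≤ ℓ ≤ k`. -/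
def coherentState (D k l : ℕ) (ε : Fin l → Fin D) (ε' : Fin (k - l) → Fin D) :
    QuantumSpace D k :=
  WithLp.toLp 2 fun α => ∏ i : Fin k,
    if h : (i : ℕ) < l then (if α i = ε ⟨i, h⟩ then 1 else 0)
    else (fourier D)ᴴ (α i) (ε' ⟨k - 1 - i, by omega⟩)

/-- The Walsh-Husimi function `WH^{k,ℓ}_ψ` on the torus: `D^k |⟨ψ|ε'·ε⟩|²` on the quantum
rectangle `[ε'·ε]`, `|ε| = ℓ`, `|ε'| = k - ℓ`. -/
def husimi (D : ℕ) [NeZero D] (k l : ℕ) (ψ : QuantumSpace D k) (x : Torus) : ℝ :=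
  (D : ℝ) ^ k *
    ‖inner ℂ ψ (coherentState D k l (fun i => (coding D x).1 i) (fun i => (coding D x).2 i))‖ ^ 2

/-- The Walsh-Husimi measure on the torus, with density `WH^{k,ℓ}_ψ` with respect to Lebesgue
measure. -/
def husimiMeasure (D : ℕ) [NeZero D] (k l : ℕ) (ψ : QuantumSpace D k) : Measure Torus :=
  (volume : Measure Torus).withDensity fun x => ENNReal.ofReal (husimi D k l ψ x)

/-- The same measure on the space of two-sided sequences, which is identified with the torus through
`D`-ary expansions. -/
def symbolicHusimiMeasure (D : ℕ) [NeZero D] (k l : ℕ) (ψ : QuantumSpace D k) :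
    Measure (SymbolSpace D) :=
  (husimiMeasure D k l ψ).map (coding D)

/-! ### Semiclassical measures -/

/-- Weak convergence of a sequence of finite measures: convergence of the integrals of all bounded
continuous functions. -/
def WeaklyConverges {X : Type*} [TopologicalSpace X] [MeasurableSpace X]
    (ν : ℕ → Measure X) (μ : Measure X) : Prop :=
  ∀ f : BoundedContinuousFunction X ℝ,
    Tendsto (fun j => ∫ x, f x ∂(ν j)) atTop (𝓝 (∫ x, f x ∂μ))

/-- Sequences `(k_j, ℓ_j)` with `0 ≤ ℓ_j ≤ k_j`, `k_j → ∞`, `ℓ_j → ∞`, `k_j - ℓ_j → ∞`. -/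
def IsSemiclassicalScale (k l : ℕ → ℕ) : Prop :=
  (∀ j, l j ≤ k j) ∧ Tendsto k atTop atTop ∧ Tendsto l atTop atTop ∧
    Tendsto (fun j => k j - l j) atTop atTop

/-- `μ` is a semiclassical measure on the torus: a probability measure which is a weak limit, along
some sequence `k_j → ∞`, of Walsh-Husimi measures of normalized eigenstates of the Walsh-quantized
baker. -/
def IsSemiclassicalMeasure (D : ℕ) [NeZero D] (μ : Measure Torus) : Prop :=
  IsProbabilityMeasure μ ∧
    ∃ (k l : ℕ → ℕ) (ψ : ∀ j, QuantumSpace D (k j)),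
      IsSemiclassicalScale k l ∧ (∀ j, IsEigenstate D (k j) (ψ j)) ∧
        WeaklyConverges (fun j => husimiMeasure D (k j) (l j) (ψ j)) μ

/-- The same notion on the space of two-sided sequences, with its own (finer) topology. -/
def IsSymbolicSemiclassicalMeasure (D : ℕ) [NeZero D] (μ : Measure (SymbolSpace D)) : Prop :=
  IsProbabilityMeasure μ ∧
    ∃ (k l : ℕ → ℕ) (ψ : ∀ j, QuantumSpace D (k j)),
      IsSemiclassicalScale k l ∧ (∀ j, IsEigenstate D (k j) (ψ j)) ∧
        WeaklyConverges (fun j => symbolicHusimiMeasure D (k j) (l j) (ψ j)) μ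

end WalshBaker

end

/-! In the position basis the quantum baker is a twisted shift: it removes the first tensor factor
and appends its image under `F*` at the end (`walshBaker_succ`). Applied to a coherent state it
moves the dot by one letter and keeps the word `ε'·ε` (`walshBaker_mulVec_wordState`). Hence, for an
eigenstate `ψ`, the Husimi weight of a word does not depend on `ℓ` and equals the position weight
`|ψ u|²` (`norm_dotProduct_wordState`), and the position distribution is stationary
(`isStationary`).

After `k` steps all factors have been twisted, so `B_k^k` is `F*` in every slot and its entries have
modulus `D^{-k/2}`. The entropic uncertainty principle for `B_k^k` compares `ψ` with `z^k ψ`, which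
has the same position distribution; so this distribution has entropy at least `k log D / 2`
(`le_entropy`). By stationarity and subadditivity, its marginals on `n` letters have entropy at
least `n log D / 2 - n² log D / k`. With `n` fixed and `k → ∞`, weak convergence on clopen cylinders
passes this bound and the invariance to the limit, which settles the symbolic case.

A semiclassical measure on the torus lifts, by compactness, to a symbolic one (`exists_symbolic`).
Evaluation of `D`-ary expansions intertwines shift and baker except where an expansion consists of
letters `D - 1` from some place on. Invariance makes the relevant bad sequences negligible except
for one fixed point, which may be an atom but changes the entropies of the refined partitions by a
bounded amount. -/

namespace WalshBaker

/-! ### Entropic uncertainty from the three lines theorem. -/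

section EntropicUncertainty

lemma negMulLog_sq (x : ℝ) : Real.negMulLog (x ^ 2) = -2 * (x ^ 2 * Real.log x) := by
  rw [Real.negMulLog, Real.log_pow]
  push_cast
  ring

variable {n : Type*}

/-- The vector `v_i |v_i|^z`. -/
noncomputable def powVec (v : n → ℂ) (z : ℂ) (i : n) : ℂ :=
  v i * Complex.exp (z * (Real.log ‖v i‖ : ℝ))

lemma norm_powVec (v : n → ℂ) (z : ℂ) (i : n) :
    ‖powVec v z i‖ = ‖v i‖ * Real.exp (z.re * Real.log ‖v i‖) := by
  simp [powVec, Complex.norm_exp]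

lemma norm_powVec_of_re_eq_zero (v : n → ℂ) {z : ℂ} (hz : z.re = 0) (i : n) :
    ‖powVec v z i‖ = ‖v i‖ := by
  simp [norm_powVec, hz]

lemma norm_powVec_of_re_eq_one (v : n → ℂ) {z : ℂ} (hz : z.re = 1) (i : n) :
    ‖powVec v z i‖ = ‖v i‖ ^ 2 := by
  rw [norm_powVec, hz, one_mul]
  -- Since `Real.log 0 = 0`, the exponential is 1 at a zero entry; the prefactor `v i` supplies the
  -- zero.
  rcases eq_or_ne (v i) 0 with h | h
  · simp [h]
  · rw [Real.exp_log (norm_pos_iff.2 h), sq]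

lemma norm_powVec_le (v : n → ℂ) {z : ℂ} (hz0 : 0 ≤ z.re) (hz1 : z.re ≤ 1) (i : n) :
    ‖powVec v z i‖ ≤ ‖v i‖ * Real.exp |Real.log ‖v i‖| := by
  rw [norm_powVec]
  gcongr
  calc z.re * Real.log ‖v i‖ ≤ z.re * |Real.log ‖v i‖| := by
        gcongr; exact le_abs_self _
    _ ≤ 1 * |Real.log ‖v i‖| := by gcongr
    _ = _ := one_mul _

lemma powVec_zero (v : n → ℂ) (i : n) : powVec v 0 i = v i := by simp [powVec]

lemma differentiable_powVec (v : n → ℂ) (i : n) : Differentiable ℂ fun z => powVec v z i := by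
  unfold powVec
  fun_prop

lemma hasDerivAt_powVec (v : n → ℂ) (i : n) :
    HasDerivAt (fun z => powVec v z i) (v i * (Real.log ‖v i‖ : ℝ)) 0 := by
  have h := (((hasDerivAt_id (0 : ℂ)).mul_const ((Real.log ‖v i‖ : ℝ) : ℂ)).cexp).const_mul (v i)
  simpa [powVec] using h

variable [Fintype n]

/-- The bilinear form to which the three lines theorem is applied. -/
noncomputable def uncertaintyForm (U : Matrix n n ℂ) (φ ψ : n → ℂ) (z : ℂ) : ℂ :=
  ∑ i, ∑ j, powVec (star φ) z i * U i j * powVec ψ z j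

lemma norm_uncertaintyForm_le_sum (U : Matrix n n ℂ) (φ ψ : n → ℂ) (z : ℂ) :
    ‖uncertaintyForm U φ ψ z‖ ≤
      ∑ i, ∑ j, ‖powVec (star φ) z i‖ * ‖U i j‖ * ‖powVec ψ z j‖ := by
  refine (norm_sum_le _ _).trans (Finset.sum_le_sum fun i _ => ?_)
  refine (norm_sum_le _ _).trans (Finset.sum_le_sum fun j _ => ?_)
  rw [norm_mul, norm_mul]

/-- On this edge of the strip both twisted vectors have `ℓ¹` norm 1, so only the largest entry of
`U` counts. -/
lemma norm_uncertaintyForm_le_sup {U : Matrix n n ℂ} {c : ℝ} (hc : ∀ i j, ‖U i j‖ ≤ c)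
    {φ ψ : n → ℂ} (hφ : ∑ i, ‖φ i‖ ^ 2 = 1) (hψ : ∑ i, ‖ψ i‖ ^ 2 = 1) {z : ℂ} (hz : z.re = 1) :
    ‖uncertaintyForm U φ ψ z‖ ≤ c := by
  refine (norm_uncertaintyForm_le_sum _ _ _ _).trans ?_
  simp only [norm_powVec_of_re_eq_one _ hz, Pi.star_apply, norm_star]
  calc _ ≤ ∑ i, ∑ j, ‖φ i‖ ^ 2 * c * ‖ψ j‖ ^ 2 := by
        gcongr with i _ j _
        exact hc i j
    _ = c := by simp only [← Finset.mul_sum, hψ, mul_one, ← Finset.sum_mul, hφ, one_mul]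

variable [DecidableEq n]

lemma sum_norm_sq_mulVec {U : Matrix n n ℂ} (hU : Uᴴ * U = 1) (v : n → ℂ) :
    ∑ i, ‖(U *ᵥ v) i‖ ^ 2 = ∑ i, ‖v i‖ ^ 2 := by
  have key : ∀ w : n → ℂ, star w ⬝ᵥ w = ((∑ i, ‖w i‖ ^ 2 : ℝ) : ℂ) := by
    intro w
    simp only [dotProduct, Pi.star_apply, RCLike.star_def, Complex.conj_mul']
    push_cast
    rfl
  have h : star (U *ᵥ v) ⬝ᵥ (U *ᵥ v) = star v ⬝ᵥ v := by
    rw [Matrix.star_mulVec, Matrix.dotProduct_mulVec, Matrix.vecMul_vecMul, hU,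
      Matrix.vecMul_one]
  rw [key, key] at h
  exact_mod_cast h

/-- On this edge the twist only changes phases: both vectors stay unit vectors and `U` is an
isometry. -/
lemma norm_uncertaintyForm_le_one {U : Matrix n n ℂ} (hU : Uᴴ * U = 1) {φ ψ : n → ℂ}
    (hφ : ∑ i, ‖φ i‖ ^ 2 = 1) (hψ : ∑ i, ‖ψ i‖ ^ 2 = 1) {z : ℂ} (hz : z.re = 0) :
    ‖uncertaintyForm U φ ψ z‖ ≤ 1 := by
  have h : uncertaintyForm U φ ψ z = ∑ i, powVec (star φ) z i * (U *ᵥ powVec ψ z) i := by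
    simp only [uncertaintyForm, Matrix.mulVec, dotProduct, Finset.mul_sum, mul_assoc]
  rw [h]
  calc _ ≤ ∑ i, ‖powVec (star φ) z i‖ * ‖(U *ᵥ powVec ψ z) i‖ := by
        refine (norm_sum_le _ _).trans_eq (by simp)
    _ ≤ ∑ i, (‖powVec (star φ) z i‖ ^ 2 + ‖(U *ᵥ powVec ψ z) i‖ ^ 2) / 2 := by
        refine Finset.sum_le_sum fun i _ => ?_
        nlinarith [sq_nonneg (‖powVec (star φ) z i‖ - ‖(U *ᵥ powVec ψ z) i‖)]
    _ = 1 := by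
        rw [← Finset.sum_div, Finset.sum_add_distrib, sum_norm_sq_mulVec hU]
        simp only [norm_powVec_of_re_eq_zero _ hz, Pi.star_apply, norm_star, hφ, hψ]
        norm_num

/-- The entropic uncertainty principle of Maassen and Uffink. -/
theorem entropic_uncertainty {U : Matrix n n ℂ} (hU : Uᴴ * U = 1) {c : ℝ} (hc0 : 0 < c)
    (hc : ∀ i j, ‖U i j‖ ≤ c) {ψ : n → ℂ} (hψ : ∑ i, ‖ψ i‖ ^ 2 = 1) :
    -2 * Real.log c ≤
      ∑ i, Real.negMulLog (‖ψ i‖ ^ 2) + ∑ i, Real.negMulLog (‖(U *ᵥ ψ) i‖ ^ 2) := by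
  set φ := U *ᵥ ψ with hφdef
  have hφ : ∑ i, ‖φ i‖ ^ 2 = 1 := by rw [hφdef, sum_norm_sq_mulVec hU, hψ]
  -- As `φ = Uψ`, unitarity gives `φ* U = ψ*`. This makes the form equal to 1 at `z = 0` and its
  -- derivative there symmetric in `φ` and `ψ`.
  have hsymm : ∀ j, ∑ i, star (φ i) * U i j = star (ψ j) := by
    intro j
    have : star φ ᵥ* U = star ψ := by
      rw [hφdef, Matrix.star_mulVec, Matrix.vecMul_vecMul, hU, Matrix.vecMul_one]
    exact congrFun this j
  have hnorm : ∀ w : ℂ, star w * w = ((‖w‖ ^ 2 : ℝ) : ℂ) := by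
    intro w
    rw [RCLike.star_def, Complex.conj_mul']
    push_cast
    rfl
  have hdiff : Differentiable ℂ (uncertaintyForm U φ ψ) := by
    unfold uncertaintyForm
    refine Differentiable.fun_sum fun i _ => Differentiable.fun_sum fun j _ => ?_
    exact ((differentiable_powVec _ i).mul_const _).mul (differentiable_powVec _ j)
  have hbdd : BddAbove ((norm ∘ uncertaintyForm U φ ψ) ''
      Complex.HadamardThreeLines.verticalClosedStrip 0 1) := by
    refine ⟨∑ i, ∑ j, (‖(star φ) i‖ * Real.exp |Real.log ‖(star φ) i‖|) * ‖U i j‖ *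
      (‖ψ j‖ * Real.exp |Real.log ‖ψ j‖|), ?_⟩
    rintro _ ⟨z, hz, rfl⟩
    refine (norm_uncertaintyForm_le_sum _ _ _ _).trans ?_
    have hz' : 0 ≤ z.re ∧ z.re ≤ 1 := hz
    gcongr with i _ j _
    · exact norm_powVec_le _ hz'.1 hz'.2 i
    · exact norm_powVec_le _ hz'.1 hz'.2 j
  have hthree : ∀ t : ℝ, 0 ≤ t → t ≤ 1 → (uncertaintyForm U φ ψ t).re ≤ c ^ t := by
    intro t ht0 ht1
    have h := Complex.HadamardThreeLines.norm_le_interp_of_mem_verticalClosedStrip₀₁'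
      (uncertaintyForm U φ ψ) (z := t) (a := 1) (b := c) ⟨by simpa using ht0, by simpa using ht1⟩
      hdiff.diffContOnCl hbdd
      (fun z hz => norm_uncertaintyForm_le_one hU hφ hψ hz)
      (fun z hz => norm_uncertaintyForm_le_sup hc hφ hψ hz)
    simp only [Real.one_rpow, one_mul, Complex.ofReal_re] at h
    exact (Complex.re_le_norm _).trans h
  have hzero : uncertaintyForm U φ ψ 0 = 1 := by
    simp only [uncertaintyForm, powVec_zero, Pi.star_apply]
    rw [Finset.sum_comm]
    simp only [← Finset.sum_mul, hsymm, hnorm]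
    exact_mod_cast hψ
  -- The derivative is minus half the sum of the two entropies. Both sides of `hthree` equal 1 at `t
  -- = 0`, so comparing right derivatives there gives the theorem.
  have hderiv : HasDerivAt (uncertaintyForm U φ ψ)
      ((∑ i, ‖φ i‖ ^ 2 * Real.log ‖φ i‖ + ∑ i, ‖ψ i‖ ^ 2 * Real.log ‖ψ i‖ : ℝ) : ℂ) 0 := by
    have h1 : HasDerivAt (uncertaintyForm U φ ψ)
        (∑ i, ∑ j, (((star φ) i * (Real.log ‖(star φ) i‖ : ℝ)) * U i j * powVec ψ 0 j +
          powVec (star φ) 0 i * U i j * (ψ j * (Real.log ‖ψ j‖ : ℝ)))) 0 := by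
      unfold uncertaintyForm
      refine HasDerivAt.fun_sum fun i _ => HasDerivAt.fun_sum fun j _ => ?_
      exact ((hasDerivAt_powVec _ i).mul_const _).mul (hasDerivAt_powVec _ j)
    convert h1 using 1
    simp only [Finset.sum_add_distrib, powVec_zero, Pi.star_apply, norm_star]
    push_cast
    congr 1
    · refine Finset.sum_congr rfl fun i _ => ?_
      have : ∑ j, U i j * ψ j = φ i := rfl
      simp only [mul_assoc, ← Finset.mul_sum, this]
      rw [mul_comm ((Real.log ‖φ i‖ : ℝ) : ℂ), ← mul_assoc, hnorm]
      push_cast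
      rfl
    · rw [Finset.sum_comm]
      refine Finset.sum_congr rfl fun j _ => ?_
      rw [← Finset.sum_mul, hsymm, ← mul_assoc, hnorm]
      push_cast
      rfl
  have hreal : HasDerivAt (fun t : ℝ => c ^ t - (uncertaintyForm U φ ψ t).re)
      (Real.log c - (∑ i, ‖φ i‖ ^ 2 * Real.log ‖φ i‖ + ∑ i, ‖ψ i‖ ^ 2 * Real.log ‖ψ i‖)) 0 := by
    have h1 : HasDerivAt (fun t : ℝ => c ^ t) (Real.log c) 0 := by
      have := (Real.hasStrictDerivAt_const_rpow hc0 0).hasDerivAt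
      simpa using this
    have h2 := HasDerivAt.real_of_complex (z := 0) (by rw [Complex.ofReal_zero]; exact hderiv)
    rw [Complex.ofReal_re] at h2
    exact h1.sub h2
  have hslope := hreal.tendsto_slope_zero_right
  have hnn := ge_of_tendsto hslope (b := 0) (by
    filter_upwards [Ioo_mem_nhdsGT (zero_lt_one' ℝ)] with t ht
    have := hthree t ht.1.le ht.2.le
    simp only [zero_add, Complex.ofReal_zero, hzero, Complex.one_re, Real.rpow_zero, sub_self,
      sub_zero, smul_eq_mul]
    exact mul_nonneg (inv_nonneg.2 ht.1.le) (sub_nonneg.2 this))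
  simp only [negMulLog_sq, ← Finset.mul_sum]
  linarith

end EntropicUncertainty

/-! ### The Walsh-quantized baker as a twisted shift of tensor factors. -/

section Quantization

variable {D : ℕ}

lemma norm_fourier (a b : Fin D) : ‖fourier D a b‖ = (Real.sqrt D)⁻¹ := by
  have h : (-2 * Complex.I * Real.pi * ((a : ℕ) : ℂ) * ((b : ℕ) : ℂ) / (D : ℂ)) =
      ((-2 * Real.pi * (a : ℕ) * (b : ℕ) / D : ℝ) : ℂ) * Complex.I := by
    push_cast
    ring
  rw [fourier, Matrix.of_apply, norm_mul, h, Complex.norm_exp_ofReal_mul_I, mul_one, norm_inv,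
    Complex.norm_real, Real.norm_of_nonneg (Real.sqrt_nonneg _)]

lemma fourier_eq (a b : Fin D) :
    fourier D a b = ((Real.sqrt D : ℝ) : ℂ)⁻¹ *
      (Complex.exp (2 * Real.pi * Complex.I / D))⁻¹ ^ ((a : ℕ) * (b : ℕ)) := by
  rw [fourier, Matrix.of_apply, ← Complex.exp_neg, ← Complex.exp_nat_mul]
  congr 2
  push_cast
  ring

/-- The quantum baker `v⁽¹⁾ ⊗ … ⊗ v⁽ᵏ⁾ ↦ v⁽²⁾ ⊗ … ⊗ v⁽ᵏ⁾ ⊗ F* v⁽¹⁾`. -/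
noncomputable def quantumShift (D k : ℕ) :
    Matrix (Fin (k + 1) → Fin D) (Fin (k + 1) → Fin D) ℂ :=
  Matrix.of fun α β =>
    if Fin.init α = Fin.tail β then star (fourier D (β 0) (α (Fin.last k))) else 0

lemma sum_words_cons {M : Type*} [AddCommMonoid M] {k : ℕ} (f : (Fin (k + 1) → Fin D) → M) :
    ∑ u, f u = ∑ w : Fin k → Fin D, ∑ a : Fin D, f (Fin.cons a w) := by
  rw [← (Fin.consEquiv fun _ => Fin D).sum_comp, Fintype.sum_prod_type, Finset.sum_comm]
  rfl

lemma sum_words_snoc {M : Type*} [AddCommMonoid M] {k : ℕ} (f : (Fin (k + 1) → Fin D) → M) :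
    ∑ u, f u = ∑ w : Fin k → Fin D, ∑ a : Fin D, f (Fin.snoc w a) := by
  rw [← (Fin.snocEquiv fun _ => Fin D).sum_comp, Fintype.sum_prod_type, Finset.sum_comm]
  rfl

/-- The coherent state labelled by the word `ε'_{k-ℓ} … ε'_1 ε_1 … ε_ℓ`. -/
noncomputable def wordState (D k l : ℕ) (u : Fin k → Fin D) (α : Fin k → Fin D) : ℂ :=
  ∏ i : Fin k, if h : (i : ℕ) < l then
      -- The bound `h'` always holds when `i < l`; quantifying over it avoids a proof inside the
      -- definition.
      (if ∀ h' : i + (k - l) < k, α i = u ⟨i + (k - l), h'⟩ then 1 else 0)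
    else star (fourier D (u ⟨i - l, by omega⟩) (α i))

lemma wordState_self (k : ℕ) (u : Fin k → Fin D) : wordState D k k u = Pi.single u 1 := by
  funext α
  simp only [wordState, Fin.is_lt, dif_pos, Nat.sub_self, Nat.add_zero, Fin.eta,
    forall_const, Pi.single_apply]
  by_cases h : α = u
  · simp [h]
  · obtain ⟨i, hi⟩ := Function.ne_iff.1 h
    rw [if_neg h]
    exact Finset.prod_eq_zero (Finset.mem_univ i) (if_neg hi)

lemma quantumShift_mulVec_snoc {k : ℕ} (v : (Fin (k + 1) → Fin D) → ℂ) (w : Fin k → Fin D)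
    (a : Fin D) :
    (quantumShift D k *ᵥ v) (Fin.snoc w a) =
      ∑ b, star (fourier D b a) * v (Fin.cons b w) := by
  rw [Matrix.mulVec, dotProduct, sum_words_cons, Finset.sum_eq_single w]
  · simp [quantumShift]
  · intro w' _ hw
    simp [quantumShift, hw.symm]
  · simp

/-- The position factor `e_{ε_1}` leaves the front and returns at the end as the momentum factor `F*
e_{ε_1}`: the word is kept and the dot moves past one letter. -/
lemma quantumShift_mulVec_wordState {k l : ℕ} (hl : l ≤ k) (u : Fin (k + 1) → Fin D) :
    quantumShift D k *ᵥ wordState D (k + 1) (l + 1) u = wordState D (k + 1) l u := by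
  funext α
  obtain ⟨⟨a, w⟩, rfl⟩ := (Fin.snocEquiv fun _ => Fin D).surjective α
  change (quantumShift D k *ᵥ _) (Fin.snoc w a) = wordState D (k + 1) l u (Fin.snoc w a)
  have hne : ∀ i : Fin k, (i : ℕ) < l → i + (k + 1 - l) < k + 1 := fun i hi => by omega
  rw [quantumShift_mulVec_snoc]
  simp only [wordState]
  rw [Fin.prod_univ_castSucc]
  simp only [Fin.prod_univ_succ, Fin.cons_zero, Fin.cons_succ, Fin.snoc_castSucc, Fin.snoc_last,
    Fin.val_zero, Fin.val_succ, Fin.val_castSucc, Fin.val_last, Nat.zero_lt_succ, dif_pos,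
    not_lt.2 hl, dif_neg, not_false_eq_true]
  have hb : ∀ b : Fin D, (∀ h' : 0 + (k + 1 - (l + 1)) < k + 1,
      b = u ⟨0 + (k + 1 - (l + 1)), h'⟩) ↔ b = u ⟨k - l, by omega⟩ := by
    intro b
    have e : 0 + (k + 1 - (l + 1)) = k - l := by omega
    simp only [e]
    exact ⟨fun h => h (by omega), fun h _ => h⟩
  simp only [hb, ite_mul, one_mul, zero_mul, mul_ite, mul_zero, Finset.sum_ite_eq',
    Finset.mem_univ, if_true]
  rw [mul_comm]
  congr 1
  refine Finset.prod_congr rfl fun i _ => ?_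
  by_cases hi : (i : ℕ) < l
  · have e : (i : ℕ) + 1 + (k + 1 - (l + 1)) = i + (k + 1 - l) := by omega
    simp only [Nat.add_lt_add_iff_right, hi, dif_pos, e]
  · simp only [Nat.add_lt_add_iff_right, hi, dif_neg, not_false_eq_true]
    congr 3
    ext
    simp only
    omega

variable [NeZero D]

lemma fourier_mul_conjTranspose : fourier D * (fourier D)ᴴ = 1 := by
  have hD : (D : ℂ) ≠ 0 := Nat.cast_ne_zero.2 (NeZero.ne D)
  set ζ : ℂ := Complex.exp (2 * Real.pi * Complex.I / D) with hζdef
  have hζ : IsPrimitiveRoot ζ D := Complex.isPrimitiveRoot_exp D (NeZero.ne D)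
  have hζ0 : ζ ≠ 0 := Complex.exp_ne_zero _
  have hstar : star ζ = ζ⁻¹ := by
    rw [RCLike.star_def, ← Complex.inv_eq_conj (hζ.norm'_eq_one (NeZero.ne D))]
  have hsq : ((Real.sqrt D : ℝ) : ℂ)⁻¹ * ((Real.sqrt D : ℝ) : ℂ)⁻¹ = (D : ℂ)⁻¹ := by
    rw [← mul_inv, ← Complex.ofReal_mul, Real.mul_self_sqrt (Nat.cast_nonneg D)]
    simp
  ext a b
  have hterm : ∀ c : Fin D, fourier D a c * star (fourier D b c) =
      (D : ℂ)⁻¹ * (ζ⁻¹ ^ (a : ℕ) * ζ ^ (b : ℕ)) ^ (c : ℕ) := by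
    intro c
    rw [fourier_eq, fourier_eq, ← hζdef, star_mul', star_pow, star_inv₀, star_inv₀, hstar, inv_inv,
      RCLike.star_def, Complex.conj_ofReal, ← hsq, mul_pow, ← pow_mul, ← pow_mul]
    ring
  rw [Matrix.mul_apply]
  simp only [Matrix.conjTranspose_apply, hterm]
  rw [← Finset.mul_sum, Fin.sum_univ_eq_sum_range
    (fun c => (ζ⁻¹ ^ (a : ℕ) * ζ ^ (b : ℕ)) ^ c) D]
  rcases eq_or_ne a b with rfl | hab
  · rw [Matrix.one_apply_eq, ← mul_pow, inv_mul_cancel₀ hζ0]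
    simp [hD]
  · have hne : ζ⁻¹ ^ (a : ℕ) * ζ ^ (b : ℕ) ≠ 1 := by
      intro h
      rw [inv_pow, inv_mul_eq_one₀ (pow_ne_zero _ hζ0)] at h
      exact hab (Fin.ext (hζ.pow_inj a.2 b.2 h))
    rw [Matrix.one_apply_ne hab, geom_sum_eq hne, mul_pow, ← pow_mul, ← pow_mul, mul_comm (a : ℕ),
      mul_comm (b : ℕ), pow_mul, pow_mul, inv_pow, hζ.pow_eq_one]
    simp

lemma sum_fourier_mul_star (a b : Fin D) :
    ∑ c, fourier D a c * star (fourier D b c) = if a = b then 1 else 0 := by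
  have := congrFun (congrFun (fourier_mul_conjTranspose (D := D)) a) b
  rwa [Matrix.mul_apply, Matrix.one_apply] at this

lemma walsh_mul_conjTranspose (k : ℕ) : walsh D k * (walsh D k)ᴴ = 1 := by
  ext α γ
  rw [Matrix.mul_apply, Matrix.one_apply]
  simp only [walsh, Matrix.conjTranspose_apply, Matrix.of_apply, star_prod,
    ← Finset.prod_mul_distrib]
  have h1 : ∑ β : Fin k → Fin D,
      ∏ i, fourier D (α i) (β i.rev) * star (fourier D (γ i) (β i.rev)) =
      ∑ β : Fin k → Fin D, ∏ i, fourier D (α i) (β i) * star (fourier D (γ i) (β i)) :=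
    Fintype.sum_equiv (Fin.revPerm.arrowCongr (Equiv.refl (Fin D))) _ _ fun β => by
      simp [Equiv.arrowCongr]
  rw [h1, ← Fintype.prod_sum (fun i c => fourier D (α i) c * star (fourier D (γ i) c))]
  simp only [sum_fourier_mul_star]
  by_cases h : α = γ
  · simp [h]
  · obtain ⟨i, hi⟩ := Function.ne_iff.1 h
    rw [if_neg h]
    exact Finset.prod_eq_zero (Finset.mem_univ i) (if_neg hi)

/-- The Walsh transform reverses the factors, so its `F` on the last letter meets the `F*` of the
shift and cancels it, which forces equal first letters. Working with the product avoids inverting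
`walsh`. -/
lemma walsh_mul_quantumShift (k : ℕ) :
    walsh D (k + 1) * quantumShift D k = walshBlocks D k := by
  ext α β
  rw [Matrix.mul_apply, sum_words_snoc]
  simp only [quantumShift, walsh, walshBlocks, Matrix.of_apply, Fin.init_snoc, Fin.snoc_last]
  rw [Finset.sum_eq_single (Fin.tail β)]
  · simp only [if_true, Fin.prod_univ_succ, Fin.rev_zero, Fin.rev_succ, Fin.snoc_last,
      Fin.snoc_castSucc]
    have h : ∀ c, fourier D (α 0) c * (∏ i : Fin k, fourier D (α i.succ) (Fin.tail β i.rev)) *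
        star (fourier D (β 0) c) = (∏ i : Fin k, fourier D (α i.succ) (Fin.tail β i.rev)) *
          (fourier D (α 0) c * star (fourier D (β 0) c)) := fun c => by ring
    simp only [h, ← Finset.mul_sum, sum_fourier_mul_star]
    rw [mul_ite, mul_one, mul_zero]
    rfl
  · intro w _ hw
    simp [hw]
  · simp

lemma walshBaker_succ (k : ℕ) : walshBaker D (k + 1) = quantumShift D k := by
  have h : IsUnit (walsh D (k + 1)).det :=
    Matrix.isUnit_det_of_right_inverse (walsh_mul_conjTranspose (k + 1))
  rw [walshBaker, ← walsh_mul_quantumShift, Matrix.nonsing_inv_mul_cancel_left _ _ h]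

lemma sum_norm_sq_fourier (v : Fin D → ℂ) :
    ∑ a, ‖∑ b, star (fourier D b a) * v b‖ ^ 2 = ∑ b, ‖v b‖ ^ 2 := by
  refine sum_norm_sq_mulVec (U := (fourier D)ᴴ) ?_ v
  rw [Matrix.conjTranspose_conjTranspose, fourier_mul_conjTranspose]

lemma conjTranspose_mul_quantumShift (k : ℕ) : (quantumShift D k)ᴴ * quantumShift D k = 1 := by
  ext α β
  rw [Matrix.mul_apply, sum_words_snoc, Matrix.one_apply]
  simp only [Matrix.conjTranspose_apply, quantumShift, Matrix.of_apply, Fin.init_snoc,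
    Fin.snoc_last]
  rw [Finset.sum_eq_single (Fin.tail β)]
  · by_cases h : Fin.tail β = Fin.tail α
    · simp only [h, if_true, star_star, sum_fourier_mul_star]
      have : (α 0 = β 0) ↔ α = β := by
        refine ⟨fun h0 => ?_, fun h => by rw [h]⟩
        rw [← Fin.cons_self_tail α, ← Fin.cons_self_tail β, h0, h]
      simp [this]
    · have : α ≠ β := fun h' => h (by rw [h'])
      simp [h, this]
  · intro w _ hw
    simp [hw]
  · simp

lemma conjTranspose_mul_walshBaker (k : ℕ) : (walshBaker D k)ᴴ * walshBaker D k = 1 := by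
  cases k with
  | zero => simp [walshBaker]
  | succ k => rw [walshBaker_succ, conjTranspose_mul_quantumShift]

lemma walshBaker_mulVec_wordState {k l : ℕ} (hl : l + 1 ≤ k) (u : Fin k → Fin D) :
    walshBaker D k *ᵥ wordState D k (l + 1) u = wordState D k l u := by
  cases k with
  | zero => omega
  | succ k => rw [walshBaker_succ, quantumShift_mulVec_wordState (by omega)]

lemma walshBaker_pow_mulVec_wordState {k l : ℕ} (hl : l ≤ k) (u : Fin k → Fin D) :
    (walshBaker D k ^ l) *ᵥ wordState D k k u = wordState D k (k - l) u := by
  induction l with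
  | zero => simp
  | succ l ih =>
    rw [pow_succ', ← Matrix.mulVec_mulVec, ih (by omega),
      show k - l = (k - (l + 1)) + 1 by omega, walshBaker_mulVec_wordState (by omega)]

/-- After `k` steps every position letter has become a momentum letter. All entries then have the
same modulus `D^{-k/2}`. -/
lemma walshBaker_pow_apply (k : ℕ) (α u : Fin k → Fin D) :
    (walshBaker D k ^ k) α u = ∏ i, star (fourier D (u i) (α i)) := by
  have h := congrFun (walshBaker_pow_mulVec_wordState le_rfl u) α
  rw [wordState_self, Matrix.mulVec_single_one, Nat.sub_self] at h
  simpa [wordState] using h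

end Quantization

/-! ### Position distribution of an eigenstate. -/

section Eigenstates

variable {D k : ℕ} {ψ : QuantumSpace D k}

lemma IsEigenstate.sum_norm_sq (h : IsEigenstate D k ψ) : ∑ u, ‖ψ u‖ ^ 2 = 1 := by
  rw [← EuclideanSpace.norm_sq_eq, h.1, one_pow]

variable [NeZero D]

lemma IsEigenstate.exists_norm_eq_one (h : IsEigenstate D k ψ) :
    ∃ z : ℂ, ‖z‖ = 1 ∧ walshBaker D k *ᵥ ψ.ofLp = z • ψ.ofLp := by
  obtain ⟨z, hz⟩ := h.2
  refine ⟨z, ?_, hz⟩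
  have h1 := sum_norm_sq_mulVec (conjTranspose_mul_walshBaker k) ψ.ofLp
  rw [hz] at h1
  simp only [Pi.smul_apply, smul_eq_mul, norm_mul, mul_pow, ← Finset.mul_sum, h.sum_norm_sq,
    mul_one] at h1
  exact (pow_eq_one_iff_of_nonneg (norm_nonneg z) two_ne_zero).1 h1

/-- By unitarity one step of the baker on the coherent state can be moved to `ψ`, where it is only a
phase. At `l = k` the coherent states are the position basis. -/
lemma IsEigenstate.norm_dotProduct_wordState (h : IsEigenstate D k ψ) {l : ℕ} (hl : l ≤ k)
    (u : Fin k → Fin D) : ‖star ψ.ofLp ⬝ᵥ wordState D k l u‖ = ‖ψ u‖ := by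
  obtain ⟨z, hz, hB⟩ := h.exists_norm_eq_one
  induction hl using Nat.decreasingInduction with
  | self => simp [wordState_self]
  | of_succ l hl ih =>
    rw [← ih, ← walshBaker_mulVec_wordState hl]
    have h1 : star (walshBaker D k *ᵥ ψ.ofLp) ⬝ᵥ
        (walshBaker D k *ᵥ wordState D k (l + 1) u) =
        star ψ.ofLp ⬝ᵥ wordState D k (l + 1) u := by
      rw [Matrix.star_mulVec, Matrix.dotProduct_mulVec, Matrix.vecMul_vecMul,
        conjTranspose_mul_walshBaker, Matrix.vecMul_one]
    rw [hB, star_smul, smul_dotProduct] at h1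
    rw [← h1, norm_smul, norm_star, hz, one_mul]

/-- In `Bψ = zψ` the last letter arises from the first by `F*`; summing over it removes this
unitary. This is the source of stationarity. -/
lemma IsEigenstate.sum_norm_sq_snoc {ψ : QuantumSpace D (k + 1)} (h : IsEigenstate D (k + 1) ψ)
    (w : Fin k → Fin D) :
    ∑ a, ‖ψ (Fin.snoc w a)‖ ^ 2 = ∑ a, ‖ψ (Fin.cons a w)‖ ^ 2 := by
  obtain ⟨z, hz, hB⟩ := h.exists_norm_eq_one
  rw [walshBaker_succ] at hB
  rw [← sum_norm_sq_fourier fun a => ψ (Fin.cons a w)]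
  refine Finset.sum_congr rfl fun a _ => ?_
  rw [← quantumShift_mulVec_snoc, hB, Pi.smul_apply, norm_smul, hz, one_mul]

/-- The position distribution of an eigenstate has at least half of the maximal entropy. -/
lemma IsEigenstate.le_entropy (h : IsEigenstate D k ψ) :
    k * (Real.log D / 2) ≤ ∑ u, Real.negMulLog (‖ψ u‖ ^ 2) := by
  obtain ⟨z, hz, hB⟩ := h.exists_norm_eq_one
  have hpow : ∀ n : ℕ, (walshBaker D k ^ n) *ᵥ ψ.ofLp = z ^ n • ψ.ofLp := by
    intro n
    induction n with
    | zero => simp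
    | succ n ih => rw [pow_succ', ← Matrix.mulVec_mulVec, ih, Matrix.mulVec_smul, hB, smul_smul,
        pow_succ]
  have hU : ∀ n : ℕ, (walshBaker D k ^ n)ᴴ * walshBaker D k ^ n = 1 := by
    intro n
    have hu : walshBaker D k ∈ Matrix.unitaryGroup (Fin k → Fin D) ℂ :=
      Matrix.mem_unitaryGroup_iff'.2 (conjTranspose_mul_walshBaker k)
    exact Matrix.mem_unitaryGroup_iff'.1 (pow_mem hu n)
  have hD : (0 : ℝ) < D := Nat.cast_pos.2 (NeZero.pos D)
  -- The eigenvalue has modulus 1, so both entropies in the uncertainty relation are that of `ψ`;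
  -- this is where the factor `1/2` appears.
  have hu := entropic_uncertainty (hU k) (c := (Real.sqrt D)⁻¹ ^ k) (by positivity)
    (fun α u => by rw [walshBaker_pow_apply]; simp [norm_prod, norm_fourier]) h.sum_norm_sq
  rw [hpow] at hu
  simp only [Pi.smul_apply, smul_eq_mul, norm_mul, norm_pow, hz, one_pow, one_mul, Real.log_pow,
    Real.log_inv, Real.log_sqrt hD.le] at hu
  linarith

end Eigenstates

/-! ### Entropy of finite partitions. -/

section FiniteEntropy

lemma sum_negMulLog_le_log_card {ι : Type*} [Fintype ι] [Nonempty ι] {p : ι → ℝ}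
    (hp : ∀ i, 0 ≤ p i) (hsum : ∑ i, p i = 1) :
    ∑ i, Real.negMulLog (p i) ≤ Real.log (Fintype.card ι) := by
  have hN : (0 : ℝ) < Fintype.card ι := Nat.cast_pos.2 Fintype.card_pos
  have key : ∀ i, Real.negMulLog (p i) ≤
      p i * Real.log (Fintype.card ι) + ((Fintype.card ι : ℝ)⁻¹ - p i) := by
    intro i
    rcases (hp i).eq_or_lt with h | h
    · simp [← h]
    · have h1 := Real.log_le_sub_one_of_pos (inv_pos.2 (mul_pos h hN))
      rw [Real.log_inv, Real.log_mul h.ne' hN.ne'] at h1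
      have h2 := mul_le_mul_of_nonneg_left h1 h.le
      rw [mul_sub, mul_inv, ← mul_assoc, mul_inv_cancel₀ h.ne'] at h2
      rw [Real.negMulLog]
      linarith
  refine (Finset.sum_le_sum fun i _ => key i).trans_eq ?_
  rw [Finset.sum_add_distrib, Finset.sum_sub_distrib, ← Finset.sum_mul, hsum]
  simp [hN.ne']

/-- Apply `log x ≤ x - 1` to `x = a i * b j / p (i, j)`, with `a`, `b` the marginals; the
corrections `a i * b j - p (i, j)` sum to zero. -/
lemma sum_negMulLog_le_add {ι κ : Type*} [Fintype ι] [Fintype κ] {p : ι × κ → ℝ}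
    (hp : ∀ x, 0 ≤ p x) (hsum : ∑ x, p x = 1) :
    ∑ x, Real.negMulLog (p x) ≤
      ∑ i, Real.negMulLog (∑ j, p (i, j)) + ∑ j, Real.negMulLog (∑ i, p (i, j)) := by
  set a : ι → ℝ := fun i => ∑ j, p (i, j) with ha
  set b : κ → ℝ := fun j => ∑ i, p (i, j) with hb
  have ha1 : ∑ i, a i = 1 := by rw [← hsum, Fintype.sum_prod_type]
  have hb1 : ∑ j, b j = 1 := by rw [← hsum, Fintype.sum_prod_type_right]
  have key : ∀ i j, Real.negMulLog (p (i, j)) ≤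
      -(p (i, j) * Real.log (a i)) - p (i, j) * Real.log (b j) + (a i * b j - p (i, j)) := by
    intro i j
    have hai : p (i, j) ≤ a i :=
      Finset.single_le_sum (f := fun j => p (i, j)) (fun j _ => hp _) (Finset.mem_univ j)
    have hbj : p (i, j) ≤ b j :=
      Finset.single_le_sum (f := fun i => p (i, j)) (fun i _ => hp _) (Finset.mem_univ i)
    rcases (hp (i, j)).eq_or_lt with h | h
    · simp only [← h] at hai hbj ⊢
      simpa using mul_nonneg hai hbj
    · have hai' := h.trans_le hai
      have hbj' := h.trans_le hbj
      have h1 := Real.log_le_sub_one_of_pos (div_pos (mul_pos hai' hbj') h)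
      rw [Real.log_div (mul_pos hai' hbj').ne' h.ne', Real.log_mul hai'.ne' hbj'.ne'] at h1
      have h2 := mul_le_mul_of_nonneg_left h1 h.le
      rw [mul_sub (p (i, j)) (_ / _), mul_div_cancel₀ _ h.ne'] at h2
      rw [Real.negMulLog]
      linarith
  calc ∑ x, Real.negMulLog (p x) = ∑ i, ∑ j, Real.negMulLog (p (i, j)) :=
        Fintype.sum_prod_type _
    _ ≤ ∑ i, ∑ j, (-(p (i, j) * Real.log (a i)) - p (i, j) * Real.log (b j) +
        (a i * b j - p (i, j))) :=
      Finset.sum_le_sum fun i _ => Finset.sum_le_sum fun j _ => key i j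
    _ = ∑ i, ∑ j, -(p (i, j) * Real.log (a i)) - ∑ j, ∑ i, p (i, j) * Real.log (b j) +
        ((∑ i, a i) * (∑ j, b j) - ∑ i, a i) := by
      simp only [Finset.sum_add_distrib, Finset.sum_sub_distrib, Finset.sum_mul_sum]
      rw [Finset.sum_comm (f := fun i j => p (i, j) * Real.log (b j))]
    _ = _ := by
      rw [ha1, hb1]
      simp only [Finset.sum_neg_distrib, ← Finset.sum_mul, Real.negMulLog, neg_mul]
      ring

/-- The entropy of the partition of a probability space into the fibres of a map. -/
noncomputable abbrev fibreEntropy {Ω ι : Type*} [MeasurableSpace Ω] [Fintype ι] (ρ : Measure Ω)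
    (f : Ω → ι) : ℝ :=
  cellEntropy ρ fun y => f ⁻¹' {y}

variable {Ω : Type*} [MeasurableSpace Ω] (ρ : Measure Ω)

lemma fibreEntropy_comp_equiv {ι κ : Type*} [Fintype ι] [Fintype κ] (e : ι ≃ κ) (f : Ω → ι) :
    fibreEntropy ρ (e ∘ f) = fibreEntropy ρ f := by
  refine (Fintype.sum_equiv e _ _ fun y => ?_).symm
  congr 2
  ext x
  simp

lemma fibreEntropy_comp {Ω' ι : Type*} [MeasurableSpace Ω'] [Fintype ι] [MeasurableSpace ι]
    [MeasurableSingletonClass ι] {T : Ω → Ω'} (hT : Measurable T) {f : Ω' → ι}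
    (hf : Measurable f) : fibreEntropy ρ (f ∘ T) = fibreEntropy (ρ.map T) f := by
  refine Finset.sum_congr rfl fun y _ => ?_
  rw [map_measureReal_apply hT (hf (measurableSet_singleton y))]
  rfl

variable [IsProbabilityMeasure ρ]

lemma sum_measureReal_fibre_inter {ι : Type*} [Fintype ι] [MeasurableSpace ι]
    [MeasurableSingletonClass ι] {f : Ω → ι} (hf : Measurable f) (s : Set Ω) :
    ∑ y, ρ.real (s ∩ f ⁻¹' {y}) = ρ.real s := by
  classical
  have h := measureReal_biUnion_finset (μ := ρ.restrict s) (s := Finset.univ)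
    (f := fun y => f ⁻¹' {y})
    (fun y _ z _ hyz => Disjoint.preimage f (Set.disjoint_singleton.2 hyz))
    (fun y _ => hf (measurableSet_singleton y))
  have hu : (⋃ y ∈ (Finset.univ : Finset ι), f ⁻¹' {y}) = Set.univ := by
    ext x
    simp
  rw [hu, measureReal_restrict_apply MeasurableSet.univ, Set.univ_inter] at h
  rw [h]
  refine Finset.sum_congr rfl fun y _ => ?_
  rw [measureReal_restrict_apply (hf (measurableSet_singleton y)), Set.inter_comm]

lemma sum_measureReal_fibre {ι : Type*} [Fintype ι] [MeasurableSpace ι]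
    [MeasurableSingletonClass ι] {f : Ω → ι} (hf : Measurable f) :
    ∑ y, ρ.real (f ⁻¹' {y}) = 1 := by
  have := sum_measureReal_fibre_inter ρ hf Set.univ
  simpa using this

lemma fibreEntropy_nonneg {ι : Type*} [Fintype ι] (f : Ω → ι) : 0 ≤ fibreEntropy ρ f :=
  Finset.sum_nonneg fun _ _ => Real.negMulLog_nonneg measureReal_nonneg measureReal_le_one

lemma fibreEntropy_le_log_card {ι : Type*} [Fintype ι] [Nonempty ι] [MeasurableSpace ι]
    [MeasurableSingletonClass ι] {f : Ω → ι} (hf : Measurable f) :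
    fibreEntropy ρ f ≤ Real.log (Fintype.card ι) :=
  sum_negMulLog_le_log_card (fun _ => measureReal_nonneg) (sum_measureReal_fibre ρ hf)

lemma fibreEntropy_prod_le {ι κ : Type*} [Fintype ι] [MeasurableSpace ι]
    [MeasurableSingletonClass ι] [Fintype κ] [MeasurableSpace κ] [MeasurableSingletonClass κ]
    {f : Ω → ι} (hf : Measurable f) {g : Ω → κ} (hg : Measurable g) :
    fibreEntropy ρ (fun x => (f x, g x)) ≤ fibreEntropy ρ f + fibreEntropy ρ g := by
  have hfg : ∀ i j, (fun x => (f x, g x)) ⁻¹' {(i, j)} = f ⁻¹' {i} ∩ g ⁻¹' {j} := by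
    intro i j
    ext x
    simp
  have h := sum_negMulLog_le_add (p := fun y => ρ.real ((fun x => (f x, g x)) ⁻¹' {y}))
    (fun _ => measureReal_nonneg) (sum_measureReal_fibre ρ (hf.prodMk hg))
  simp only [hfg, sum_measureReal_fibre_inter ρ hg] at h
  have h' : ∀ j, ∑ i, ρ.real (f ⁻¹' {i} ∩ g ⁻¹' {j}) = ρ.real (g ⁻¹' {j}) := fun j => by
    simp only [Set.inter_comm (f ⁻¹' _), sum_measureReal_fibre_inter ρ hf]
  simp only [h'] at h
  refine le_trans (Finset.sum_le_sum fun y _ => ?_) h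
  rw [← hfg]

end FiniteEntropy

/-! ### Stationary measures on finite words. -/

section Words

variable {D : ℕ} [NeZero D]

/-- The `r` letters that follow the first `s` letters of a word of length `k` (with a default value
beyond the end of the word). -/
def window (D k s r : ℕ) [NeZero D] (u : Fin k → Fin D) (i : Fin r) : Fin D :=
  if h : s + i < k then u ⟨s + i, h⟩ else 0

lemma window_self (k : ℕ) : window D k 0 k = id := by
  funext u i
  simp [window]

lemma append_window {k a b : ℕ} (u : Fin k → Fin D) :
    Fin.append (window D k 0 a u) (window D k a b u) = window D k 0 (a + b) u := by
  funext i
  refine Fin.addCases (fun i => ?_) (fun i => ?_) i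
  · simp [window]
  · simp [window]

lemma window_comp_init {k s r : ℕ} (h : s + r ≤ k) (u : Fin (k + 1) → Fin D) :
    window D k s r (Fin.init u) = window D (k + 1) s r u := by
  funext i
  have h1 : s + i < k := by omega
  have h2 : s + i < k + 1 := by omega
  simp only [window, h1, h2, dif_pos, Fin.init]
  rfl

lemma window_comp_tail {k s r : ℕ} (u : Fin (k + 1) → Fin D) :
    window D k s r (Fin.tail u) = window D (k + 1) (s + 1) r u := by
  funext i
  simp only [window, Fin.tail, show s + 1 + i = s + i + 1 by omega, Nat.add_lt_add_iff_right]
  rfl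

/-- Stationarity of a measure on words of length `k`. -/
def IsStationary {D k : ℕ} [NeZero D] (ρ : Measure (Fin k → Fin D)) : Prop :=
  ∀ s r, s + r + 1 ≤ k → ρ.map (window D k (s + 1) r) = ρ.map (window D k s r)

variable {k : ℕ} {ρ : Measure (Fin k → Fin D)}

lemma IsStationary.map_window (h : IsStationary ρ) {s r : ℕ} (hs : s + r ≤ k) :
    ρ.map (window D k s r) = ρ.map (window D k 0 r) := by
  induction s with
  | zero => rfl
  | succ s ih => rw [h s r (by omega), ih (by omega)]

variable [IsProbabilityMeasure ρ]

/-- The block of length `a + b` is a pair of blocks, and by stationarity the second has the law of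
an initial block. -/
lemma IsStationary.fibreEntropy_window_add_le (h : IsStationary ρ) {a b : ℕ} (hab : a + b ≤ k) :
    fibreEntropy ρ (window D k 0 (a + b)) ≤
      fibreEntropy ρ (window D k 0 a) + fibreEntropy ρ (window D k 0 b) := by
  have h1 : window D k 0 (a + b) =
      (Fin.appendEquiv a b) ∘ fun u => (window D k 0 a u, window D k a b u) := by
    funext u
    exact (append_window u).symm
  have h2 : fibreEntropy ρ (window D k a b) = fibreEntropy ρ (window D k 0 b) := by
    have e1 := fibreEntropy_comp ρ (T := window D k a b) (f := id)
      (measurable_of_countable _) measurable_id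
    have e2 := fibreEntropy_comp ρ (T := window D k 0 b) (f := id)
      (measurable_of_countable _) measurable_id
    rw [h.map_window hab] at e1
    exact e1.trans e2.symm
  rw [h1, fibreEntropy_comp_equiv, ← h2]
  exact fibreEntropy_prod_le ρ (measurable_of_countable _) (measurable_of_countable _)

lemma IsStationary.fibreEntropy_window_mul_le (h : IsStationary ρ) {n q : ℕ} (hq : n * q ≤ k) :
    fibreEntropy ρ (window D k 0 (n * q)) ≤ q * fibreEntropy ρ (window D k 0 n) := by
  induction q with
  | zero =>
    have := fibreEntropy_le_log_card ρ (f := window D k 0 (n * 0)) (measurable_of_countable _)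
    simpa using this
  | succ q ih =>
    rw [Nat.mul_succ] at hq ⊢
    refine (h.fibreEntropy_window_add_le hq).trans ?_
    have := ih (by omega)
    push_cast
    linarith

lemma fibreEntropy_window_le (r : ℕ) :
    fibreEntropy ρ (window D k 0 r) ≤ r * Real.log D := by
  have := fibreEntropy_le_log_card ρ (f := window D k 0 r) (measurable_of_countable _)
  simpa using this

/-- The entropy of a stationary measure on words is controlled by that of its marginals. -/
lemma IsStationary.fibreEntropy_id_le (h : IsStationary ρ) {n : ℕ} (hn : 0 < n) :
    fibreEntropy ρ id ≤
      k / n * fibreEntropy ρ (window D k 0 n) + n * Real.log D := by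
  -- Cut the word into `k / n` blocks of length `n` and a remainder of fewer than `n` letters, which
  -- costs at most `n log D`.
  have h1 := h.fibreEntropy_window_add_le (Nat.div_add_mod k n).le
  rw [Nat.div_add_mod, window_self] at h1
  have h2 := h.fibreEntropy_window_mul_le (Nat.mul_div_le k n)
  have h3 := fibreEntropy_window_le (ρ := ρ) (k % n)
  have h4 : ((k / n : ℕ) : ℝ) * fibreEntropy ρ (window D k 0 n) ≤
      k / n * fibreEntropy ρ (window D k 0 n) :=
    mul_le_mul_of_nonneg_right Nat.cast_div_le (fibreEntropy_nonneg ρ _)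
  have h5 : ((k % n : ℕ) : ℝ) * Real.log D ≤ n * Real.log D :=
    mul_le_mul_of_nonneg_right (Nat.cast_le.2 (Nat.mod_lt k hn).le) (Real.log_natCast_nonneg D)
  linarith

end Words

/-! ### Stationarity and marginal entropy for the position measure. -/

section PositionMeasure

variable {D k : ℕ}

/-- The distribution of the position of a quantum state. -/
noncomputable def positionMeasure (ψ : QuantumSpace D k) : Measure (Fin k → Fin D) :=
  ∑ u, ENNReal.ofReal (‖ψ u‖ ^ 2) • Measure.dirac u

open Classical in
lemma positionMeasure_apply (ψ : QuantumSpace D k) (s : Set (Fin k → Fin D)) :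
    positionMeasure ψ s = ∑ u, if u ∈ s then ENNReal.ofReal (‖ψ u‖ ^ 2) else 0 := by
  simp [positionMeasure, Measure.finsetSum_apply, Set.indicator_apply]

lemma positionMeasure_singleton (ψ : QuantumSpace D k) (u : Fin k → Fin D) :
    positionMeasure ψ {u} = ENNReal.ofReal (‖ψ u‖ ^ 2) := by
  simp [positionMeasure_apply]

lemma IsEigenstate.isProbabilityMeasure {ψ : QuantumSpace D k} (h : IsEigenstate D k ψ) :
    IsProbabilityMeasure (positionMeasure ψ) := by
  constructor
  simp only [positionMeasure_apply, Set.mem_univ, if_true]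
  rw [← ENNReal.ofReal_sum_of_nonneg fun _ _ => by positivity, h.sum_norm_sq, ENNReal.ofReal_one]

variable [NeZero D]

lemma IsEigenstate.isStationary {ψ : QuantumSpace D k} (h : IsEigenstate D k ψ) :
    IsStationary (positionMeasure ψ) := by
  intro s r hsr
  obtain ⟨k, rfl⟩ : ∃ m, k = m + 1 := ⟨k - 1, by omega⟩
  -- Deleting the first or the last letter gives the same law; neighbouring windows are one window
  -- of these two shortened words.
  have hmap : (positionMeasure ψ).map Fin.tail = (positionMeasure ψ).map Fin.init := by
    refine Measure.ext_of_singleton fun w => ?_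
    rw [Measure.map_apply (measurable_of_countable _) (measurableSet_singleton w),
      Measure.map_apply (measurable_of_countable _) (measurableSet_singleton w),
      positionMeasure_apply, positionMeasure_apply, sum_words_cons, sum_words_snoc]
    simp only [Set.mem_preimage, Fin.tail_cons, Fin.init_snoc, Set.mem_singleton_iff]
    rw [Finset.sum_eq_single w (by intro _ _ hw; simp [hw]) (by simp),
      Finset.sum_eq_single w (by intro _ _ hw; simp [hw]) (by simp)]
    simp only [if_true]
    rw [← ENNReal.ofReal_sum_of_nonneg fun _ _ => by positivity,
      ← ENNReal.ofReal_sum_of_nonneg fun _ _ => by positivity, h.sum_norm_sq_snoc]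
  have h1 : window D (k + 1) (s + 1) r = window D k s r ∘ Fin.tail := by
    funext u
    exact (window_comp_tail u).symm
  have h2 : window D (k + 1) s r = window D k s r ∘ Fin.init := by
    funext u
    exact (window_comp_init (by omega) u).symm
  rw [h1, h2, ← Measure.map_map (measurable_of_countable _) (measurable_of_countable _),
    ← Measure.map_map (measurable_of_countable _) (measurable_of_countable _), hmap]

/-- The full entropy bound is multiplied by `n / k`. The error vanishes for fixed `n` as `k → ∞`,
the order in which the limits are taken. -/
lemma IsEigenstate.le_fibreEntropy_window {ψ : QuantumSpace D k} (h : IsEigenstate D k ψ)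
    (hk : 0 < k) {n : ℕ} (hn : 0 < n) :
    n * (Real.log D / 2) - n ^ 2 * Real.log D / k ≤
      fibreEntropy (positionMeasure ψ) (window D k 0 n) := by
  have := h.isProbabilityMeasure
  have h1 := h.isStationary.fibreEntropy_id_le hn
  have h2 : fibreEntropy (positionMeasure ψ) id = ∑ u, Real.negMulLog (‖ψ u‖ ^ 2) := by
    refine Finset.sum_congr rfl fun u _ => ?_
    rw [show (fun y => id ⁻¹' {y}) u = {u} from rfl, measureReal_def, positionMeasure_singleton,
      ENNReal.toReal_ofReal (by positivity)]
  have h3 := h.le_entropy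
  rw [← h2] at h3
  have h4 := mul_le_mul_of_nonneg_left (h3.trans h1) (show (0 : ℝ) ≤ n / k by positivity)
  have hk' : (k : ℝ) ≠ 0 := by positivity
  have hn' : (n : ℝ) ≠ 0 := by positivity
  have e1 : (n : ℝ) / k * (k * (Real.log D / 2)) = n * (Real.log D / 2) := by field_simp
  have e2 : ∀ x : ℝ, (n : ℝ) / k * (k / n * x + n * Real.log D) =
      x + n ^ 2 * Real.log D / k := by
    intro x
    field_simp
  rw [e1, e2] at h4
  linarith

end PositionMeasure

/-! ### Lebesgue measure of `D`-ary cylinders. -/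

section Digits

variable {D : ℕ} [NeZero D]

lemma rep_mem (t : UnitAddCircle) : rep t ∈ Set.Ico (0 : ℝ) 1 := by
  have := (AddCircle.equivIco (1 : ℝ) 0 t).2
  exact ⟨this.1, this.2.trans_eq (zero_add 1)⟩

lemma coe_rep (t : UnitAddCircle) : ((rep t : ℝ) : UnitAddCircle) = t :=
  AddCircle.coe_equivIco

lemma measurable_rep : Measurable rep :=
  measurable_subtype_coe.comp (AddCircle.measurableEquivIco 1 0).measurable

lemma measurable_digits : Measurable fun x : ℝ => Real.digits x D :=
  measurable_pi_lambda _ fun _ =>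
    (measurable_of_countable (Fin.ofNat D)).comp
      (Nat.measurable_floor.comp (measurable_id.mul_const _))

lemma measurable_coding : Measurable (coding D) :=
  (measurable_digits.comp (measurable_rep.comp measurable_fst)).prodMk
    (measurable_digits.comp (measurable_rep.comp measurable_snd))

lemma measurable_digits_rep (n : ℕ) :
    Measurable fun (t : UnitAddCircle) (i : Fin n) => Real.digits (rep t) D i :=
  measurable_pi_lambda _ fun i =>
    (measurable_pi_apply (i : ℕ)).comp (measurable_digits.comp measurable_rep)

lemma volume_digits_le (n : ℕ) (w : Fin n → Fin D) :
    (volume : Measure UnitAddCircle).real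
      ((fun (t : UnitAddCircle) (i : Fin n) => Real.digits (rep t) D i) ⁻¹' {w}) ≤
        (D : ℝ)⁻¹ ^ n := by
  set r : ℝ := (D : ℝ)⁻¹ ^ n with hr
  have hr0 : 0 ≤ r := by positivity
  set a : ℝ := ∑ i : Fin n, (w i : ℝ) * ((D : ℝ) ^ ((i : ℕ) + 1))⁻¹ with ha
  -- The truncated expansion `a` is the left end of an interval of length `r`, so the ball is
  -- centred at `a + r / 2`.
  have hsub : (fun (t : UnitAddCircle) (i : Fin n) => Real.digits (rep t) D i) ⁻¹' {w} ⊆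
      Metric.closedBall (((a + r / 2 : ℝ)) : UnitAddCircle) (r / 2) := by
    intro t ht
    have hsum : ∑ i ∈ Finset.range n, Real.ofDigitsTerm (Real.digits (rep t) D) i = a := by
      rw [← Fin.sum_univ_eq_sum_range, ha]
      refine Finset.sum_congr rfl fun i _ => ?_
      rw [Real.ofDigitsTerm, ← congrFun ht i]
    have h1 := Real.sum_ofDigitsTerm_digits_le (b := D) (rep_mem t) n
    have h2 := Real.le_sum_ofDigitsTerm_digits (b := D) (rep_mem t) n
    rw [hsum] at h1 h2
    rw [Metric.mem_closedBall, dist_eq_norm, ← coe_rep t, ← AddCircle.coe_sub]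
    refine (QuotientAddGroup.norm_mk_le_norm (S := AddSubgroup.zmultiples (1 : ℝ))).trans ?_
    rw [Real.norm_eq_abs, abs_le]
    constructor <;> linarith
  refine (measureReal_mono hsub).trans ?_
  rw [measureReal_def, AddCircle.volume_closedBall]
  refine ENNReal.toReal_le_of_le_ofReal hr0 (ENNReal.ofReal_le_ofReal ?_)
  refine (min_le_right _ _).trans_eq ?_
  ring

/-- The `D ^ n` cylinders have total mass 1 and each has mass at most `D^{-n}`, so every bound is an
equality. -/
lemma volume_digits (n : ℕ) (w : Fin n → Fin D) :
    (volume : Measure UnitAddCircle)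
      ((fun (t : UnitAddCircle) (i : Fin n) => Real.digits (rep t) D i) ⁻¹' {w}) =
        ENNReal.ofReal ((D : ℝ)⁻¹ ^ n) := by
  have hD : (D : ℝ) ≠ 0 := Nat.cast_ne_zero.2 (NeZero.ne D)
  have hprob : IsProbabilityMeasure (volume : Measure UnitAddCircle) := ⟨by simp⟩
  have h := (Finset.sum_eq_sum_iff_of_le (s := Finset.univ)
    fun w _ => volume_digits_le (D := D) n w).1 (by
      rw [sum_measureReal_fibre volume (measurable_digits_rep n)]
      simp [hD])
  rw [← h w (Finset.mem_univ w), ofReal_measureReal]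

end Digits

/-! ### Central words and cylinders in the symbol space. -/

section SymbolSpace

variable {D : ℕ}

/-- The word `ε'_{k-ℓ} … ε'_1 ε_1 … ε_ℓ` of a two-sided sequence. -/
def centralWord (D k l : ℕ) (x : SymbolSpace D) (i : Fin k) : Fin D :=
  if (i : ℕ) < k - l then x.2 (k - l - 1 - i) else x.1 (i - (k - l))

lemma continuous_centralWord (k l : ℕ) : Continuous (centralWord D k l) := by
  refine continuous_pi fun i => ?_
  unfold centralWord
  split_ifs
  · exact (continuous_apply _).comp continuous_snd
  · exact (continuous_apply _).comp continuous_fst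

lemma measurable_centralWord (k l : ℕ) : Measurable (centralWord D k l) :=
  (continuous_centralWord k l).measurable

lemma continuous_shift : Continuous (shift D) := by
  refine (continuous_pi fun n => ?_).prodMk (continuous_pi fun n => ?_)
  · exact (continuous_apply _).comp continuous_fst
  · cases n with
    | zero => exact (continuous_apply _).comp continuous_fst
    | succ n => exact (continuous_apply _).comp continuous_snd

lemma iterate_shift_fst (x : SymbolSpace D) (n m : ℕ) : ((shift D)^[n] x).1 m = x.1 (m + n) := by
  induction n generalizing m with
  | zero => rfl
  | succ n ih =>
    rw [Function.iterate_succ_apply']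
    exact (ih (m + 1)).trans (congrArg x.1 (by omega))

variable [NeZero D]

lemma window_centralWord {k l k' l' s : ℕ} (hl : l ≤ k) (hl' : l' ≤ k') (hll : l' ≤ l)
    (hs : s + (k' - l') = k - l) (x : SymbolSpace D) :
    window D k s k' (centralWord D k l x) = centralWord D k' l' x := by
  funext i
  have h1 : s + i < k := by omega
  simp only [window, h1, dif_pos, centralWord]
  by_cases h : (i : ℕ) < k' - l'
  · rw [if_pos h, if_pos (by omega)]
    exact congrArg x.2 (by omega)
  · rw [if_neg h, if_neg (by omega)]
    exact congrArg x.1 (by omega)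

/-- The shift moves the dot one letter to the right, hence the extra 1 in the start of the window
and in `hll`. -/
lemma window_succ_centralWord {k l k' l' s : ℕ} (hl : l ≤ k) (hl' : l' ≤ k') (hll : l' + 1 ≤ l)
    (hs : s + (k' - l') = k - l) (x : SymbolSpace D) :
    window D k (s + 1) k' (centralWord D k l x) = centralWord D k' l' (shift D x) := by
  funext i
  have h1 : s + 1 + i < k := by omega
  simp only [window, h1, dif_pos, centralWord, shift]
  by_cases h : (i : ℕ) < k' - l'
  · rw [if_pos h]
    by_cases h' : (i : ℕ) + 1 < k' - l'
    · rw [if_pos (by omega)]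
      obtain ⟨m, hm⟩ : ∃ m, k' - l' - 1 - i = m + 1 := ⟨k' - l' - 1 - i - 1, by omega⟩
      rw [hm]
      exact congrArg x.2 (by omega)
    · rw [if_neg (by omega), show k' - l' - 1 - (i : ℕ) = 0 by omega]
      exact congrArg x.1 (by omega)
  · rw [if_neg h, if_neg (by omega)]
    exact congrArg x.1 (by omega)

/-- Symmetric cylinders generate the product σ-algebra, and two of them are always cylinders over a
common longer word, so they form a π-system. -/
lemma measure_ext_centralWord {μ ν : Measure (SymbolSpace D)} [IsProbabilityMeasure μ]
    [IsProbabilityMeasure ν]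
    (h : ∀ (N : ℕ) (A : Set (Fin (N + N) → Fin D)),
      μ (centralWord D (N + N) N ⁻¹' A) = ν (centralWord D (N + N) N ⁻¹' A)) : μ = ν := by
  refine ext_of_generate_finite
    {s | ∃ (N : ℕ) (A : Set (Fin (N + N) → Fin D)), centralWord D (N + N) N ⁻¹' A = s}
    (le_antisymm ?_ ?_) ?_ ?_ (by simp)
  · set C : Set (Set (SymbolSpace D)) :=
      {s | ∃ (N : ℕ) (A : Set (Fin (N + N) → Fin D)), centralWord D (N + N) N ⁻¹' A = s} with hC
    have hw : ∀ N, Measurable[MeasurableSpace.generateFrom C] (centralWord D (N + N) N) :=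
      fun N A _ => MeasurableSpace.measurableSet_generateFrom ⟨N, A, rfl⟩
    have h1 : Measurable[MeasurableSpace.generateFrom C] fun x : SymbolSpace D => x.1 := by
      refine @measurable_pi_lambda _ _ _ (MeasurableSpace.generateFrom C) _ _ fun i => ?_
      have e : (fun x : SymbolSpace D => x.1 i) =
          (fun u => u ⟨i + 1 + i, by omega⟩) ∘ centralWord D (i + 1 + (i + 1)) (i + 1) := by
        funext x
        simp [centralWord]
      rw [e]
      exact (measurable_of_countable _).comp (hw (i + 1))
    have h2 : Measurable[MeasurableSpace.generateFrom C] fun x : SymbolSpace D => x.2 := by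
      refine @measurable_pi_lambda _ _ _ (MeasurableSpace.generateFrom C) _ _ fun i => ?_
      have e : (fun x : SymbolSpace D => x.2 i) =
          (fun u => u ⟨0, by omega⟩) ∘ centralWord D (i + 1 + (i + 1)) (i + 1) := by
        funext x
        simp [centralWord]
      rw [e]
      exact (measurable_of_countable _).comp (hw (i + 1))
    have h3 : Measurable[MeasurableSpace.generateFrom C] fun x : SymbolSpace D => x :=
      Measurable.prodMk h1 h2
    exact fun s hs => h3 hs
  · refine MeasurableSpace.generateFrom_le ?_
    rintro _ ⟨N, A, rfl⟩
    exact measurable_centralWord _ _ (Set.toFinite A).measurableSet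
  · have hmono : ∀ {N M : ℕ}, N ≤ M → ∀ A : Set (Fin (N + N) → Fin D),
        centralWord D (N + N) N ⁻¹' A =
          centralWord D (M + M) M ⁻¹' (window D (M + M) (M - N) (N + N) ⁻¹' A) := by
      intro N M hNM A
      ext x
      simp only [Set.mem_preimage]
      rw [window_centralWord (l' := N) (by omega) (by omega) hNM (by omega)]
    rintro _ ⟨N, A, rfl⟩ _ ⟨M, B, rfl⟩ -
    rw [hmono (le_max_left N M) A, hmono (le_max_right N M) B, ← Set.preimage_inter]
    exact ⟨max N M, _, rfl⟩
  · rintro _ ⟨N, A, rfl⟩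
    exact h N A

end SymbolSpace

/-! ### Husimi measures of eigenstates in terms of the position measure. -/

section Husimi

variable {D k l : ℕ}

lemma coherentState_eq_wordState (hl : l ≤ k) (x : SymbolSpace D) :
    (coherentState D k l (fun i => x.1 i) (fun i => x.2 i)).ofLp =
      wordState D k l (centralWord D k l x) := by
  funext α
  simp only [coherentState, wordState]
  refine Finset.prod_congr rfl fun i _ => ?_
  by_cases h : (i : ℕ) < l
  · have h1 : (i : ℕ) + (k - l) < k := by omega
    have h2 : ¬ (i : ℕ) + (k - l) < k - l := by omega
    simp [h, h1, centralWord]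
  · have h1 : (i : ℕ) - l < k - l := by omega
    have h2 : k - l - 1 - (i - l) = k - 1 - i := by omega
    simp only [h, dif_neg, not_false_eq_true, Matrix.conjTranspose_apply, centralWord, h1, if_pos,
      h2]

lemma preimage_comp_apply (ν : Measure (SymbolSpace D)) {k' : ℕ} (f : SymbolSpace D → Fin k → Fin D)
    (hf : Measurable f) (g : (Fin k → Fin D) → Fin k' → Fin D) (A : Set (Fin k' → Fin D)) :
    ν ((g ∘ f) ⁻¹' A) = (ν.map f).map g A := by
  rw [Measure.map_map (measurable_of_countable g) hf, Measure.map_apply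
    ((measurable_of_countable g).comp hf) (Set.toFinite A).measurableSet]

variable [NeZero D]

lemma IsEigenstate.husimi_eq {ψ : QuantumSpace D k} (h : IsEigenstate D k ψ) (hl : l ≤ k)
    (x : Torus) : husimi D k l ψ x = (D : ℝ) ^ k * ‖ψ (centralWord D k l (coding D x))‖ ^ 2 := by
  rw [husimi, EuclideanSpace.inner_eq_star_dotProduct, coherentState_eq_wordState hl,
    dotProduct_comm, h.norm_dotProduct_wordState hl]

lemma volume_centralWord_coding (hl : l ≤ k) (u : Fin k → Fin D) :
    (volume : Measure Torus) ((fun x => centralWord D k l (coding D x)) ⁻¹' {u}) =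
      ENNReal.ofReal ((D : ℝ)⁻¹ ^ k) := by
  have hset : (fun x => centralWord D k l (coding D x)) ⁻¹' {u} =
      ((fun (t : UnitAddCircle) (i : Fin l) => Real.digits (rep t) D i) ⁻¹'
        {fun i : Fin l => u ⟨k - l + i, by omega⟩}) ×ˢ
      ((fun (t : UnitAddCircle) (i : Fin (k - l)) => Real.digits (rep t) D i) ⁻¹'
        {fun i : Fin (k - l) => u ⟨k - l - 1 - i, by omega⟩}) := by
    ext x
    simp only [Set.mem_preimage, Set.mem_singleton_iff, Set.mem_prod, funext_iff, centralWord,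
      coding]
    constructor
    · intro h
      refine ⟨fun i => ?_, fun i => ?_⟩
      · rw [← h, if_neg (by simp)]
        simp
      · rw [← h, if_pos (by simp only; omega)]
        congr 1
        simp only
        omega
    · rintro ⟨h1, h2⟩ i
      by_cases hi : (i : ℕ) < k - l
      · rw [if_pos hi]
        have := h2 ⟨k - l - 1 - i, by omega⟩
        simp only at this
        rw [this]
        congr 1
        ext
        simp only
        omega
      · rw [if_neg hi]
        have := h1 ⟨i - (k - l), by omega⟩
        simp only at this
        rw [this]
        congr 1
        ext
        simp only
        omega
  rw [hset, Measure.volume_eq_prod, Measure.prod_prod, volume_digits, volume_digits,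
    ← ENNReal.ofReal_mul (by positivity), ← pow_add, Nat.add_sub_cancel' hl]

/-- The area `D^{-k}` of a quantum rectangle cancels the factor `D^k` of the density. The result is
free of `l`, so stationarity of words becomes approximate shift invariance. -/
lemma IsEigenstate.map_centralWord {ψ : QuantumSpace D k} (h : IsEigenstate D k ψ) (hl : l ≤ k) :
    (symbolicHusimiMeasure D k l ψ).map (centralWord D k l) = positionMeasure ψ := by
  have hm : Measurable fun x => centralWord D k l (coding D x) :=
    (measurable_centralWord k l).comp measurable_coding
  have hD : (D : ℝ) ≠ 0 := Nat.cast_ne_zero.2 (NeZero.ne D)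
  refine Measure.ext_of_singleton fun u => ?_
  rw [symbolicHusimiMeasure, Measure.map_map (measurable_centralWord k l) measurable_coding,
    show centralWord D k l ∘ coding D = fun x => centralWord D k l (coding D x) from rfl,
    Measure.map_apply hm (measurableSet_singleton u), husimiMeasure,
    withDensity_apply _ (hm (measurableSet_singleton u)), positionMeasure_singleton]
  have hc : ∀ x ∈ (fun x => centralWord D k l (coding D x)) ⁻¹' {u},
      ENNReal.ofReal (husimi D k l ψ x) = ENNReal.ofReal ((D : ℝ) ^ k * ‖ψ u‖ ^ 2) := by
    intro x hx
    rw [h.husimi_eq hl, show centralWord D k l (coding D x) = u from hx]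
  change ∫⁻ x in (fun x => centralWord D k l (coding D x)) ⁻¹' {u}, _ = _
  rw [setLIntegral_congr_fun (hm (measurableSet_singleton u)) hc, setLIntegral_const,
    volume_centralWord_coding hl, ← ENNReal.ofReal_mul (by positivity)]
  congr 1
  rw [inv_pow]
  field_simp

lemma IsEigenstate.isProbabilityMeasure_symbolicHusimiMeasure {ψ : QuantumSpace D k}
    (h : IsEigenstate D k ψ) (hl : l ≤ k) :
    IsProbabilityMeasure (symbolicHusimiMeasure D k l ψ) := by
  have := h.isProbabilityMeasure
  rw [← h.map_centralWord hl] at this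
  exact Measure.isProbabilityMeasure_of_map (centralWord D k l)

/-- Husimi measures of eigenstates are invariant up to the length of the words they resolve. -/
lemma IsEigenstate.symbolicHusimiMeasure_shift {ψ : QuantumSpace D k} (h : IsEigenstate D k ψ)
    (hl : l ≤ k) {N : ℕ} (hN : N + 1 ≤ l) (hN' : N ≤ k - l) (A : Set (Fin (N + N) → Fin D)) :
    symbolicHusimiMeasure D k l ψ (shift D ⁻¹' (centralWord D (N + N) N ⁻¹' A)) =
      symbolicHusimiMeasure D k l ψ (centralWord D (N + N) N ⁻¹' A) := by
  have e1 : centralWord D (N + N) N ∘ shift D =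
      window D k (k - l - N + 1) (N + N) ∘ centralWord D k l := by
    funext x
    exact (window_succ_centralWord hl (by omega) hN (by omega) x).symm
  have e2 : centralWord D (N + N) N = window D k (k - l - N) (N + N) ∘ centralWord D k l := by
    funext x
    exact (window_centralWord hl (by omega) (by omega) (by omega) x).symm
  rw [← Set.preimage_comp, e1, e2, preimage_comp_apply _ _ (measurable_centralWord k l),
    preimage_comp_apply _ _ (measurable_centralWord k l), h.map_centralWord hl,
    h.isStationary _ _ (by omega)]

lemma IsEigenstate.le_fibreEntropy_centralWord {ψ : QuantumSpace D k} (h : IsEigenstate D k ψ)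
    (hl : l ≤ k) {n : ℕ} (hn : 0 < n) (hnl : n ≤ l) :
    n * (Real.log D / 2) - n ^ 2 * Real.log D / k ≤
      fibreEntropy (symbolicHusimiMeasure D k l ψ) (centralWord D n n) := by
  have e : centralWord D n n = window D k (k - l) n ∘ centralWord D k l := by
    funext x
    exact (window_centralWord hl le_rfl hnl (by omega) x).symm
  have e1 := fibreEntropy_comp (positionMeasure ψ) (T := window D k (k - l) n) (f := id)
    (measurable_of_countable _) measurable_id
  have e2 := fibreEntropy_comp (positionMeasure ψ) (T := window D k 0 n) (f := id)
    (measurable_of_countable _) measurable_id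
  rw [h.isStationary.map_window (by omega), ← e2, Function.id_comp, Function.id_comp] at e1
  rw [e, fibreEntropy_comp _ (measurable_centralWord k l) (measurable_of_countable _),
    h.map_centralWord hl, e1]
  exact h.le_fibreEntropy_window (by omega) hn

end Husimi

/-! ### The semiclassical limit in the symbol space. -/

section SymbolicLimit

/-- The indicator of a clopen set is itself a continuous test function. Cylinders are clopen in the
symbol space, which is why limits are taken there and not on the torus. -/
lemma WeaklyConverges.tendsto_measureReal {X : Type*} [TopologicalSpace X] [MeasurableSpace X]
    [OpensMeasurableSpace X] {ν : ℕ → Measure X} {μ : Measure X} (h : WeaklyConverges ν μ)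
    {s : Set X} (hs : IsClopen s) : Tendsto (fun j => (ν j).real s) atTop (𝓝 (μ.real s)) := by
  have := h (BoundedContinuousFunction.indicator s hs)
  have e : ∀ ρ : Measure X, ∫ x, s.indicator 1 x ∂ρ = ρ.real s := fun ρ =>
    integral_indicator_one hs.2.measurableSet
  simpa [e] using this

lemma isClopen_preimage_centralWord {D : ℕ} [NeZero D] (k l : ℕ) (A : Set (Fin k → Fin D)) :
    IsClopen (centralWord D k l ⁻¹' A) :=
  (isClopen_discrete A).preimage (continuous_centralWord k l)

variable {D : ℕ}

/-- The partition of the symbol space according to the letter `ε_1`. -/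
def letterPartition (D : ℕ) : MeasurablePartition (SymbolSpace D) D where
  cell a := {x | x.1 0 = a}
  measurableSet_cell a :=
    measurableSet_eq_fun ((measurable_pi_apply 0).comp measurable_fst) measurable_const
  disjoint_cell a b hab := Set.disjoint_left.2 fun _ h1 h2 => hab (h1.symm.trans h2)
  iUnion_cell := by
    ext x
    simp

lemma refinedCell_letterPartition (n : ℕ) (a : Fin n → Fin D) :
    (letterPartition D).refinedCell (shift D) n a = centralWord D n n ⁻¹' {a} := by
  ext x
  simp only [MeasurablePartition.refinedCell, letterPartition, Set.mem_iInter, Set.mem_preimage,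
    Set.mem_ofPred_eq, iterate_shift_fst, Set.mem_singleton_iff, funext_iff, centralWord]
  simp

variable [NeZero D] {μ : Measure (SymbolSpace D)}

lemma IsSymbolicSemiclassicalMeasure.measurePreserving_shift
    (h : IsSymbolicSemiclassicalMeasure D μ) : MeasurePreserving (shift D) μ μ := by
  obtain ⟨hμ, k, l, ψ, ⟨hlk, hk, hl, hkl⟩, hψ, hconv⟩ := h
  have hsm : Measurable (shift D) := continuous_shift.measurable
  refine ⟨hsm, ?_⟩
  have := Measure.isProbabilityMeasure_map (μ := μ) hsm.aemeasurable
  refine measure_ext_centralWord fun N A => ?_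
  have hA := isClopen_preimage_centralWord (N + N) N A
  have h1 := hconv.tendsto_measureReal hA
  have h2 := hconv.tendsto_measureReal (hA.preimage continuous_shift)
  rw [Measure.map_apply hsm hA.2.measurableSet]
  have heq : μ.real (shift D ⁻¹' (centralWord D (N + N) N ⁻¹' A)) =
      μ.real (centralWord D (N + N) N ⁻¹' A) := by
    refine tendsto_nhds_unique h2 (h1.congr' ?_)
    -- A fixed cylinder and its shift must lie inside the resolved word: here `ℓ → ∞` and `k - ℓ →
    -- ∞` are both needed.
    filter_upwards [hl.eventually_ge_atTop (N + 1), hkl.eventually_ge_atTop N] with j hj hj'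
    rw [measureReal_def, measureReal_def,
      (hψ j).symbolicHusimiMeasure_shift (hlk j) hj hj']
  rwa [measureReal_def, measureReal_def, ENNReal.toReal_eq_toReal_iff' (by finiteness)
    (by finiteness)] at heq

lemma IsSymbolicSemiclassicalMeasure.le_fibreEntropy
    (h : IsSymbolicSemiclassicalMeasure D μ) {n : ℕ} (hn : 0 < n) :
    n * (Real.log D / 2) ≤ fibreEntropy μ (centralWord D n n) := by
  obtain ⟨hμ, k, l, ψ, ⟨hlk, hk, hl, hkl⟩, hψ, hconv⟩ := h
  have h1 : Tendsto (fun j => fibreEntropy (symbolicHusimiMeasure D (k j) (l j) (ψ j))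
      (centralWord D n n)) atTop (𝓝 (fibreEntropy μ (centralWord D n n))) :=
    tendsto_finsetSum _ fun w _ => (Real.continuous_negMulLog.tendsto _).comp
      (hconv.tendsto_measureReal (isClopen_preimage_centralWord n n {w}))
  have h2 : Tendsto (fun j => n * (Real.log D / 2) - n ^ 2 * Real.log D / k j) atTop
      (𝓝 (n * (Real.log D / 2) - 0)) :=
    tendsto_const_nhds.sub
      (tendsto_const_nhds.div_atTop (tendsto_natCast_atTop_atTop.comp hk))
  rw [sub_zero] at h2
  refine le_of_tendsto_of_tendsto h2 h1 ?_
  filter_upwards [hl.eventually_ge_atTop n] with j hj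
  exact (hψ j).le_fibreEntropy_centralWord (hlk j) hn hj

/-- The slack `C` disappears after division by `n`; it is there for the exceptional fixed point in
the torus case. -/
lemma le_ksEntropy_of_eventually_le {X : Type*} [MeasurableSpace X] {T : X → X} {μ : Measure X}
    {m : ℕ} (P : MeasurablePartition X m) {c C : ℝ}
    (h : ∀ n : ℕ, 0 < n → n * c - C ≤ cellEntropy μ (P.refinedCell T n)) :
    (c : EReal) ≤ ksEntropy T μ := by
  refine le_trans ?_ (le_iSup₂_of_le m P le_rfl)
  have hlim : Tendsto (fun n : ℕ => ((c - C / n : ℝ) : EReal)) atTop (𝓝 (c : EReal)) := by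
    have h1 : Tendsto (fun n : ℕ => c - C / n) atTop (𝓝 (c - 0)) :=
      tendsto_const_nhds.sub (tendsto_const_nhds.div_atTop tendsto_natCast_atTop_atTop)
    rw [sub_zero] at h1
    exact (continuous_coe_real_ereal.tendsto c).comp h1
  rw [← hlim.liminf_eq]
  refine liminf_le_liminf ?_
  filter_upwards [eventually_gt_atTop 0] with n hn
  have hn' : (0 : ℝ) < n := Nat.cast_pos.2 hn
  rw [EReal.coe_le_coe_iff, le_div_iff₀ hn', sub_mul, div_mul_cancel₀ _ hn'.ne']
  linarith [h n hn]

lemma IsSymbolicSemiclassicalMeasure.le_ksEntropy (h : IsSymbolicSemiclassicalMeasure D μ) :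
    ((Real.log D / 2 : ℝ) : EReal) ≤ ksEntropy (shift D) μ := by
  refine le_ksEntropy_of_eventually_le (letterPartition D) (C := 0) fun n hn => ?_
  rw [sub_zero, funext (refinedCell_letterPartition n)]
  exact h.le_fibreEntropy hn

end SymbolicLimit

/-! ### From the symbol space to the torus. -/

section Projection

variable {D : ℕ}

/-- The point of the torus whose coordinates have the given `D`-ary expansions. -/
noncomputable def torusPoint (D : ℕ) (x : SymbolSpace D) : Torus :=
  ((Real.ofDigits x.1 : UnitAddCircle), (Real.ofDigits x.2 : UnitAddCircle))

lemma continuous_torusPoint : Continuous (torusPoint D) :=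
  ((AddCircle.continuous_mk' 1).comp (Real.continuous_ofDigits.comp continuous_fst)).prodMk
    ((AddCircle.continuous_mk' 1).comp (Real.continuous_ofDigits.comp continuous_snd))

lemma measurable_torusPoint : Measurable (torusPoint D) := continuous_torusPoint.measurable

lemma ofDigits_lt_one (hD : 1 < D) {y : ℕ → Fin D}
    (hy : ∃ i, y i ≠ ⟨D - 1, Nat.sub_one_lt_of_lt hD⟩) : Real.ofDigits y < 1 := by
  obtain ⟨i, hi⟩ := hy
  have hle : ∀ j, (y j : ℝ) ≤ (D - 1 : ℕ) := fun j => Nat.cast_le.2 (by omega)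
  have hlt : (y i : ℝ) < (D - 1 : ℕ) := by
    refine Nat.cast_lt.2 ?_
    have : (y i : ℕ) ≠ D - 1 := fun h => hi (Fin.ext h)
    omega
  rw [← Real.ofDigits_const_last_eq_one' hD]
  refine Summable.tsum_lt_tsum (i := i) (fun j => ?_) ?_ Real.summable_ofDigitsTerm
    Real.summable_ofDigitsTerm
  · exact mul_le_mul_of_nonneg_right (hle j) (by positivity)
  · exact mul_lt_mul_of_pos_right hlt (by positivity)

lemma rep_coe {t : ℝ} (ht : t ∈ Set.Ico (0 : ℝ) 1) : rep (t : UnitAddCircle) = t :=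
  AddCircle.equivIco_coe_of_mem ⟨ht.1, ht.2.trans_eq (zero_add 1).symm⟩

lemma mul_ofDigits (hD : 1 < D) (y : ℕ → Fin D) :
    D * Real.ofDigits y = (y 0 : ℕ) + Real.ofDigits fun i => y (i + 1) := by
  have hD0 : (D : ℝ) ≠ 0 := by positivity
  rw [Real.ofDigits_eq_sum_add_ofDigits y 1]
  simp only [Finset.sum_range_one, Real.ofDigitsTerm, zero_add, pow_one]
  field_simp

/-- The three strict bounds exclude a coordinate equal to 1, which `rep` would send to 0, and a tail
equal to 1, which would raise the floor by one. -/
lemma baker_torusPoint (hD : 1 < D) {x : SymbolSpace D} (h1 : Real.ofDigits x.1 < 1)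
    (h1' : Real.ofDigits (fun i => x.1 (i + 1)) < 1) (h2 : Real.ofDigits x.2 < 1) :
    baker D (torusPoint D x) = torusPoint D (shift D x) := by
  have hD0 : (D : ℝ) ≠ 0 := by positivity
  have hfloor : ⌊(D : ℝ) * Real.ofDigits x.1⌋ = ((x.1 0 : ℕ) : ℤ) := by
    rw [mul_ofDigits hD, Int.floor_eq_iff]
    push_cast
    exact ⟨le_add_of_nonneg_right (Real.ofDigits_nonneg _), by linarith⟩
  have hcons := mul_ofDigits hD (shift D x).2
  refine Prod.ext ?_ ?_
  · simp only [baker, torusPoint, rep_coe ⟨Real.ofDigits_nonneg _, h1⟩]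
    rw [mul_ofDigits hD, AddCircle.coe_add]
    have : (((x.1 0 : ℕ) : ℝ) : UnitAddCircle) = 0 := by
      have := AddCircle.coe_nsmul (1 : ℝ) (n := (x.1 0 : ℕ)) (x := 1)
      rw [AddCircle.coe_period, smul_zero, nsmul_eq_mul, mul_one] at this
      exact this
    rw [this, zero_add]
    rfl
  · simp only [baker, torusPoint, rep_coe ⟨Real.ofDigits_nonneg _, h1⟩,
      rep_coe ⟨Real.ofDigits_nonneg _, h2⟩, hfloor]
    congr 1
    rw [div_eq_iff hD0, mul_comm, hcons]
    push_cast
    rw [add_comm]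
    rfl

lemma measurable_baker : Measurable (baker D) := by
  have h1 : Measurable fun x : Torus => rep x.1 := measurable_rep.comp measurable_fst
  have h2 : Measurable fun x : Torus => rep x.2 := measurable_rep.comp measurable_snd
  refine Measurable.prodMk ?_ ?_
  · exact AddCircle.measurable_mk'.comp (h1.const_mul _)
  · refine AddCircle.measurable_mk'.comp ((h2.add ?_).div_const _)
    exact (measurable_of_countable _).comp (Int.measurable_floor.comp (h1.const_mul _))

variable [NeZero D]

lemma torusPoint_coding (hD : 1 < D) (t : Torus) : torusPoint D (coding D t) = t := by
  refine Prod.ext ?_ ?_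
  · simp only [torusPoint, coding, Real.ofDigits_digits hD (rep_mem _), coe_rep]
  · simp only [torusPoint, coding, Real.ofDigits_digits hD (rep_mem _), coe_rep]

lemma coding_torusPoint_fst (hD : 1 < D) {x : SymbolSpace D} (h1 : Real.ofDigits x.1 < 1)
    (h1' : Real.ofDigits (fun i => x.1 (i + 1)) < 1) :
    (coding D (torusPoint D x)).1 0 = x.1 0 := by
  have hfloor : ⌊Real.ofDigits x.1 * (D : ℝ) ^ (0 + 1)⌋₊ = (x.1 0 : ℕ) := by
    rw [zero_add, pow_one, mul_comm, mul_ofDigits hD,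
      Nat.floor_eq_iff (add_nonneg (Nat.cast_nonneg _) (Real.ofDigits_nonneg _))]
    exact ⟨le_add_of_nonneg_right (Real.ofDigits_nonneg _), by linarith⟩
  simp only [coding, torusPoint, rep_coe ⟨Real.ofDigits_nonneg _, h1⟩, Real.digits, hfloor]
  ext
  simp

/-- A semiclassical measure on the torus is the image of one on the symbol space. -/
lemma IsSemiclassicalMeasure.exists_symbolic (hD : 1 < D) {μ : Measure Torus}
    (h : IsSemiclassicalMeasure D μ) :
    ∃ m : Measure (SymbolSpace D), IsSymbolicSemiclassicalMeasure D m ∧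
      m.map (torusPoint D) = μ := by
  obtain ⟨hμ, k, l, ψ, ⟨hlk, hk, hl, hkl⟩, hψ, hconv⟩ := h
  let P : ℕ → ProbabilityMeasure (SymbolSpace D) := fun j =>
    ⟨symbolicHusimiMeasure D (k j) (l j) (ψ j),
      (hψ j).isProbabilityMeasure_symbolicHusimiMeasure (hlk j)⟩
  -- The symbol space is compact, so the lifted measures have a limit point `m`; `torusPoint` is
  -- continuous and undoes `coding`, so `m` projects to `μ`.
  obtain ⟨m, φ, hφ, hlim⟩ := CompactSpace.tendsto_subseq P
  rw [ProbabilityMeasure.tendsto_iff_forall_integral_tendsto] at hlim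
  have hφ' := hφ.tendsto_atTop
  refine ⟨m, ⟨inferInstance, k ∘ φ, l ∘ φ, fun j => ψ (φ j),
    ⟨fun j => hlk _, hk.comp hφ', hl.comp hφ', hkl.comp hφ'⟩, fun j => hψ _, hlim⟩, ?_⟩
  have := Measure.isProbabilityMeasure_map (μ := (m : Measure (SymbolSpace D)))
    (measurable_torusPoint (D := D)).aemeasurable
  refine ext_of_forall_integral_eq_of_IsFiniteMeasure fun f => ?_
  rw [integral_map measurable_torusPoint.aemeasurable f.continuous.aestronglyMeasurable]
  refine tendsto_nhds_unique (hlim (f.compContinuous ⟨_, continuous_torusPoint⟩)) ?_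
  refine ((hconv f).comp hφ').congr fun j => ?_
  have e := integral_map (μ := husimiMeasure D (k (φ j)) (l (φ j)) (ψ (φ j)))
    (measurable_coding (D := D)).aemeasurable
    (f.continuous.comp continuous_torusPoint).aestronglyMeasurable
  simp only [Function.comp_apply, torusPoint_coding hD] at e
  exact e.symm

end Projection

/-! ### Invariance of the projected measure. -/

section ShiftInvariant

variable {D : ℕ}

lemma measure_diff_iInter_eq_zero {X : Type*} [MeasurableSpace X] {μ : Measure X}
    [IsFiniteMeasure μ] {s : ℕ → Set X} (hs : ∀ n, MeasurableSet (s n)) (hanti : Antitone s)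
    (hμ : ∀ n, μ (s (n + 1)) = μ (s n)) : μ (s 0 \ ⋂ n, s n) = 0 := by
  rw [Set.sdiff_iInter, measure_iUnion_null_iff]
  intro n
  have hn : μ (s n) = μ (s 0) := by
    induction n with
    | zero => rfl
    | succ n ih => rw [hμ, ih]
  rw [measure_sdiff (hanti (Nat.zero_le n)) (hs n).nullMeasurableSet (by finiteness), hn,
    tsub_self]

/-- The fixed point of the shift with all letters equal to `a`. -/
def constSeq (a : Fin D) : SymbolSpace D := (fun _ => a, fun _ => a)

lemma shift_constSeq (a : Fin D) : shift D (constSeq a) = constSeq a := by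
  refine Prod.ext rfl (funext fun n => ?_)
  cases n <;> rfl

lemma eq_constSeq_of_shift {a : Fin D} {x : SymbolSpace D} (h : shift D x = constSeq a) :
    x = constSeq a := by
  have h1 := congrFun (congrArg Prod.fst h)
  have h2 := congrFun (congrArg Prod.snd h)
  refine Prod.ext (funext fun n => ?_) (funext fun n => h2 (n + 1))
  cases n with
  | zero => exact h2 0
  | succ n => exact h1 n

lemma eq_constSeq_of_iterate_shift {a : Fin D} {x : SymbolSpace D} {n : ℕ}
    (h : (shift D)^[n] x = constSeq a) : x = constSeq a := by
  induction n generalizing x with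
  | zero => exact h
  | succ n ih => exact eq_constSeq_of_shift (ih h)

variable {m : Measure (SymbolSpace D)}

lemma ae_iterate_shift (hm : MeasurePreserving (shift D) m m) {p : SymbolSpace D → Prop}
    (h : ∀ᵐ x ∂m, p x) : ∀ᵐ x ∂m, ∀ n, p ((shift D)^[n] x) :=
  ae_all_iff.2 fun n => (hm.iterate n).quasiMeasurePreserving.ae h

variable [IsProbabilityMeasure m]

/-- The sets `s n` decrease to the single point `constSeq a`, and each is the shift preimage of the
next. Invariance gives them equal measure, so `s 0` is that point up to a null set. -/
lemma ae_eq_constSeq_of_fst (hm : MeasurePreserving (shift D) m m) (a : Fin D) :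
    ∀ᵐ x ∂m, (∀ i, x.1 i = a) → x = constSeq a := by
  set s : ℕ → Set (SymbolSpace D) := fun n => {x | (∀ i, x.1 i = a) ∧ ∀ i < n, x.2 i = a} with hs
  have hmeas : ∀ n, MeasurableSet (s n) := by
    intro n
    have h1 : ∀ i, MeasurableSet {x : SymbolSpace D | x.1 i = a} := fun i =>
      measurableSet_eq_fun ((measurable_pi_apply i).comp measurable_fst) measurable_const
    have h2 : ∀ i, MeasurableSet {x : SymbolSpace D | x.2 i = a} := fun i =>
      measurableSet_eq_fun ((measurable_pi_apply i).comp measurable_snd) measurable_const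
    have e : s n = (⋂ i, {x : SymbolSpace D | x.1 i = a}) ∩
        ⋂ i, ⋂ _ : i < n, {x : SymbolSpace D | x.2 i = a} := by
      ext x
      simp [hs]
    rw [e]
    exact (MeasurableSet.iInter h1).inter
      (MeasurableSet.iInter fun i => MeasurableSet.iInter fun _ => h2 i)
  have hshift : ∀ n, shift D ⁻¹' s (n + 1) = s n := by
    intro n
    ext x
    constructor
    · rintro ⟨h1, h2⟩
      refine ⟨fun i => ?_, fun i hi => h2 (i + 1) (by omega)⟩
      cases i with
      | zero => exact h2 0 (by omega)
      | succ i => exact h1 i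
    · rintro ⟨h1, h2⟩
      refine ⟨fun i => h1 (i + 1), fun i hi => ?_⟩
      cases i with
      | zero => exact h1 0
      | succ i => exact h2 i (by omega)
  have h0 := measure_diff_iInter_eq_zero (μ := m) hmeas
    (fun n n' h x hx => ⟨hx.1, fun i hi => hx.2 i (by omega)⟩)
    (fun n => by rw [← hm.measure_preimage (hmeas (n + 1)).nullMeasurableSet, hshift])
  rw [← compl_mem_ae_iff] at h0
  filter_upwards [h0] with x hx h
  by_contra hne
  refine hx ⟨⟨h, by simp⟩, fun hmem => hne (Prod.ext (funext h) (funext fun i => ?_))⟩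
  exact (Set.mem_iInter.1 hmem (i + 1)).2 i (by omega)

/-- The mirror argument: fixing the momentum letters reverses the roles, and now `s (n + 1)` is the
preimage of `s n`. -/
lemma ae_eq_constSeq_of_snd (hm : MeasurePreserving (shift D) m m) (a : Fin D) :
    ∀ᵐ x ∂m, (∀ i, x.2 i = a) → x = constSeq a := by
  set s : ℕ → Set (SymbolSpace D) := fun n => {x | (∀ i, x.2 i = a) ∧ ∀ i < n, x.1 i = a} with hs
  have hmeas : ∀ n, MeasurableSet (s n) := by
    intro n
    have h1 : ∀ i, MeasurableSet {x : SymbolSpace D | x.1 i = a} := fun i =>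
      measurableSet_eq_fun ((measurable_pi_apply i).comp measurable_fst) measurable_const
    have h2 : ∀ i, MeasurableSet {x : SymbolSpace D | x.2 i = a} := fun i =>
      measurableSet_eq_fun ((measurable_pi_apply i).comp measurable_snd) measurable_const
    have e : s n = (⋂ i, {x : SymbolSpace D | x.2 i = a}) ∩
        ⋂ i, ⋂ _ : i < n, {x : SymbolSpace D | x.1 i = a} := by
      ext x
      simp [hs]
    rw [e]
    exact (MeasurableSet.iInter h2).inter
      (MeasurableSet.iInter fun i => MeasurableSet.iInter fun _ => h1 i)
  have hshift : ∀ n, shift D ⁻¹' s n = s (n + 1) := by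
    intro n
    ext x
    constructor
    · rintro ⟨h1, h2⟩
      refine ⟨fun i => h1 (i + 1), fun i hi => ?_⟩
      cases i with
      | zero => exact h1 0
      | succ i => exact h2 i (by omega)
    · rintro ⟨h1, h2⟩
      refine ⟨fun i => ?_, fun i hi => h2 (i + 1) (by omega)⟩
      cases i with
      | zero => exact h2 0 (by omega)
      | succ i => exact h1 i
  have h0 := measure_diff_iInter_eq_zero (μ := m) hmeas
    (fun n n' h x hx => ⟨hx.1, fun i hi => hx.2 i (by omega)⟩)
    (fun n => by rw [← hshift, hm.measure_preimage (hmeas n).nullMeasurableSet])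
  rw [← compl_mem_ae_iff] at h0
  filter_upwards [h0] with x hx h
  by_contra hne
  refine hx ⟨⟨h, by simp⟩, fun hmem => hne (Prod.ext (funext fun i => ?_) (funext h))⟩
  exact (Set.mem_iInter.1 hmem (i + 1)).2 i (by omega)

/-- For an invariant measure, the only relevant sequences whose `D`-ary expansions are not proper
are the fixed point with all letters equal to `D - 1`. -/
lemma ae_ofDigits_lt_one (hD : 1 < D) (hm : MeasurePreserving (shift D) m m) :
    ∀ᵐ x ∂m, x = constSeq ⟨D - 1, Nat.sub_one_lt_of_lt hD⟩ ∨
      (Real.ofDigits x.1 < 1 ∧ Real.ofDigits (fun i => x.1 (i + 1)) < 1 ∧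
        Real.ofDigits x.2 < 1) := by
  -- Orbit points enter because the position expansion must also be proper after its first letter is
  -- removed.
  filter_upwards [ae_iterate_shift hm (ae_eq_constSeq_of_fst hm ⟨D - 1, Nat.sub_one_lt_of_lt hD⟩),
    ae_eq_constSeq_of_snd hm ⟨D - 1, Nat.sub_one_lt_of_lt hD⟩] with x h1 h2
  by_cases hx : x = constSeq ⟨D - 1, Nat.sub_one_lt_of_lt hD⟩
  · exact Or.inl hx
  · have h1' : ∀ n, ∃ i, ((shift D)^[n] x).1 i ≠ ⟨D - 1, Nat.sub_one_lt_of_lt hD⟩ := fun n => by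
      by_contra! h
      exact hx (eq_constSeq_of_iterate_shift (h1 n h))
    have h2' : ∃ i, x.2 i ≠ ⟨D - 1, Nat.sub_one_lt_of_lt hD⟩ := by
      by_contra! h
      exact hx (h2 h)
    exact Or.inr ⟨ofDigits_lt_one hD (h1' 0), ofDigits_lt_one hD (h1' 1), ofDigits_lt_one hD h2'⟩

/-- Both coordinates equal 1, that is 0 on the circle, and the baker fixes the origin. -/
lemma baker_torusPoint_constSeq (hD : 1 < D) :
    baker D (torusPoint D (constSeq ⟨D - 1, Nat.sub_one_lt_of_lt hD⟩)) =
      torusPoint D (shift D (constSeq ⟨D - 1, Nat.sub_one_lt_of_lt hD⟩)) := by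
  have h0 : torusPoint D (constSeq ⟨D - 1, Nat.sub_one_lt_of_lt hD⟩) =
      (((0 : ℝ) : UnitAddCircle), ((0 : ℝ) : UnitAddCircle)) := by
    simp only [torusPoint, constSeq, Real.ofDigits_const_last_eq_one' hD, AddCircle.coe_period,
      AddCircle.coe_zero]
  rw [shift_constSeq, h0]
  simp only [baker, rep_coe (Set.left_mem_Ico.2 zero_lt_one)]
  simp

lemma ae_baker_torusPoint (hD : 1 < D) (hm : MeasurePreserving (shift D) m m) :
    ∀ᵐ x ∂m, baker D (torusPoint D x) = torusPoint D (shift D x) := by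
  filter_upwards [ae_ofDigits_lt_one hD hm] with x hx
  rcases hx with rfl | ⟨h1, h1', h2⟩
  · exact baker_torusPoint_constSeq hD
  · exact baker_torusPoint hD h1 h1' h2

lemma measurePreserving_baker [NeZero D] (hD : 1 < D) (hm : MeasurePreserving (shift D) m m) :
    MeasurePreserving (baker D) (m.map (torusPoint D)) (m.map (torusPoint D)) := by
  refine ⟨measurable_baker, ?_⟩
  rw [Measure.map_map measurable_baker measurable_torusPoint,
    Measure.map_congr (f := baker D ∘ torusPoint D) (g := torusPoint D ∘ shift D)
      (ae_baker_torusPoint hD hm),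
    ← Measure.map_map measurable_torusPoint hm.measurable, hm.map_eq]

end ShiftInvariant

/-! ### Entropy of the projected measure. -/

section TorusEntropy

lemma negMulLog_le_one {p : ℝ} (hp : 0 ≤ p) : Real.negMulLog p ≤ 1 := by
  rcases hp.eq_or_lt with rfl | h
  · simp
  · have h1 := mul_le_mul_of_nonneg_left (Real.one_sub_inv_le_log_of_pos h) hp
    rw [mul_sub, mul_inv_cancel₀ h.ne'] at h1
    rw [Real.negMulLog]
    linarith

/-- Only the fibres over `f c` and `g c` can differ in mass, and every entropy term lies in `[0,
1]`. -/
lemma fibreEntropy_sub_two_le {Ω ι : Type*} [MeasurableSpace Ω] [Fintype ι] (ρ : Measure Ω)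
    [IsProbabilityMeasure ρ] {f g : Ω → ι} {c : Ω} (h : ∀ᵐ x ∂ρ, x = c ∨ f x = g x) :
    fibreEntropy ρ f - 2 ≤ fibreEntropy ρ g := by
  classical
  have key : ∀ y, Real.negMulLog (ρ.real (f ⁻¹' {y})) ≤ Real.negMulLog (ρ.real (g ⁻¹' {y})) +
      ((if y = f c then 1 else 0) + if y = g c then 1 else 0) := by
    intro y
    by_cases hy : y = f c ∨ y = g c
    · have h1 := negMulLog_le_one (measureReal_nonneg (μ := ρ) (s := f ⁻¹' {y}))
      have h2 := Real.negMulLog_nonneg (measureReal_nonneg (μ := ρ) (s := g ⁻¹' {y}))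
        measureReal_le_one
      have h3 : (1 : ℝ) ≤ (if y = f c then 1 else 0) + if y = g c then 1 else 0 := by
        rcases hy with hy | hy
        · rw [if_pos hy]
          exact le_add_of_nonneg_right (by split_ifs <;> simp)
        · rw [if_pos hy]
          exact le_add_of_nonneg_left (by split_ifs <;> simp)
      linarith
    · push Not at hy
      have hset : f ⁻¹' {y} =ᵐ[ρ] g ⁻¹' {y} := by
        filter_upwards [h] with x hx
        refine propext ?_
        change f x = y ↔ g x = y
        rcases hx with rfl | hx
        · exact ⟨fun h => absurd h.symm hy.1, fun h => absurd h.symm hy.2⟩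
        · rw [hx]
      rw [measureReal_congr hset]
      simp [hy.1, hy.2]
  have := Finset.sum_le_sum fun y (_ : y ∈ Finset.univ) => key y
  simp only [Finset.sum_add_distrib, Finset.sum_ite_eq', Finset.mem_univ, if_true] at this
  change ∑ y, _ - 2 ≤ ∑ y, _
  linarith

variable {D : ℕ} [NeZero D]

lemma measurable_coding_fst : Measurable fun t : Torus => (coding D t).1 0 :=
  (measurable_pi_apply 0).comp (measurable_fst.comp measurable_coding)

/-- The partition of the torus into `D` vertical strips. -/
def stripPartition (D : ℕ) [NeZero D] : MeasurablePartition Torus D where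
  cell a := {t | (coding D t).1 0 = a}
  measurableSet_cell a := measurableSet_eq_fun measurable_coding_fst measurable_const
  disjoint_cell a b hab := Set.disjoint_left.2 fun _ h1 h2 => hab (h1.symm.trans h2)
  iUnion_cell := by
    ext x
    simp

/-- The strips visited by the first `n` points of an orbit of the baker's map. -/
noncomputable def itinerary (D n : ℕ) [NeZero D] (t : Torus) (i : Fin n) : Fin D :=
  (coding D ((baker D)^[i] t)).1 0

lemma refinedCell_stripPartition (n : ℕ) (a : Fin n → Fin D) :
    (stripPartition D).refinedCell (baker D) n a = itinerary D n ⁻¹' {a} := by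
  ext x
  simp only [MeasurablePartition.refinedCell, stripPartition, Set.mem_iInter, Set.mem_preimage,
    Set.mem_ofPred_eq, Set.mem_singleton_iff, funext_iff, itinerary]

lemma measurable_itinerary (n : ℕ) : Measurable (itinerary D n) :=
  measurable_pi_lambda _ fun i => measurable_coding_fst.comp (measurable_baker.iterate i)

/-- The fixed point is a true exception: its letters are `D - 1`, but it projects to the origin,
which lies in strip 0. -/
lemma ae_itinerary_torusPoint (hD : 1 < D) {m : Measure (SymbolSpace D)} [IsProbabilityMeasure m]
    (hm : MeasurePreserving (shift D) m m) (n : ℕ) :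
    ∀ᵐ x ∂m, x = constSeq ⟨D - 1, Nat.sub_one_lt_of_lt hD⟩ ∨
      centralWord D n n x = itinerary D n (torusPoint D x) := by
  filter_upwards [ae_iterate_shift hm (ae_ofDigits_lt_one hD hm),
    ae_iterate_shift hm (ae_baker_torusPoint hD hm)] with x h1 h2
  refine or_iff_not_imp_left.2 fun hx => funext fun i => ?_
  have hiter : ∀ j, (baker D)^[j] (torusPoint D x) = torusPoint D ((shift D)^[j] x) := by
    intro j
    induction j with
    | zero => rfl
    | succ j ih => rw [Function.iterate_succ_apply', ih, h2, Function.iterate_succ_apply']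
  have hi := (h1 i).resolve_left fun h => hx (eq_constSeq_of_iterate_shift h)
  rw [itinerary, hiter, coding_torusPoint_fst hD hi.1 hi.2.1, iterate_shift_fst]
  simp [centralWord]

lemma IsSymbolicSemiclassicalMeasure.le_ksEntropy_baker (hD : 1 < D)
    {m : Measure (SymbolSpace D)} (h : IsSymbolicSemiclassicalMeasure D m) :
    ((Real.log D / 2 : ℝ) : EReal) ≤ ksEntropy (baker D) (m.map (torusPoint D)) := by
  have := h.1
  -- The constant 2 bounds the loss at the exceptional point, uniformly in `n`.
  refine le_ksEntropy_of_eventually_le (stripPartition D) (C := 2) fun n hn => ?_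
  rw [funext (refinedCell_stripPartition n)]
  change _ ≤ fibreEntropy _ (itinerary D n)
  rw [← fibreEntropy_comp m measurable_torusPoint (measurable_itinerary n)]
  have h1 := h.le_fibreEntropy hn
  have h2 := fibreEntropy_sub_two_le m (g := itinerary D n ∘ torusPoint D)
    (ae_itinerary_torusPoint hD h.measurePreserving_shift n)
  linarith

end TorusEntropy

end WalshBaker

theorem theorem2 (D : ℕ) [NeZero D] (hD : 2 ≤ D) :
    (∀ μ : MeasureTheory.Measure WalshBaker.Torus,
      WalshBaker.IsSemiclassicalMeasure D μ →
        MeasureTheory.MeasurePreserving (WalshBaker.baker D) μ μ ∧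
          ((Real.log D / 2 : ℝ) : EReal) ≤ WalshBaker.ksEntropy (WalshBaker.baker D) μ) ∧
    (∀ μ : MeasureTheory.Measure (WalshBaker.SymbolSpace D),
      WalshBaker.IsSymbolicSemiclassicalMeasure D μ →
        MeasureTheory.MeasurePreserving (WalshBaker.shift D) μ μ ∧
          ((Real.log D / 2 : ℝ) : EReal) ≤ WalshBaker.ksEntropy (WalshBaker.shift D) μ) := by
  refine ⟨fun μ hμ => ?_, fun μ hμ => ⟨hμ.measurePreserving_shift, hμ.le_ksEntropy⟩⟩
  obtain ⟨m, hm, rfl⟩ := hμ.exists_symbolic hD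
  have := hm.1
  exact ⟨WalshBaker.measurePreserving_baker hD hm.measurePreserving_shift,
    hm.le_ksEntropy_baker hD⟩
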